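/- Let $G$ be a (real, finite-dimensional) Lie group with Lie algebra $\mathfrak g$, let $\Gamma\subset G$ be a uniform discrete subgroup, that is, a discrete subgroup such that the quotient manifold $M=\Gamma\backslash G$ is compact, and assume that the de Rham cohomology $H^2(M,\mathbb R)$ is isomorphic, as a real vector space, to the Chevalley–Eilenberg cohomology $H^2(\mathfrak g)$ with trivial real coefficients. Let $J$ be a smooth almost complex structure on $M$ (not necessarily left-invariant). Let $\pi_{1,1}$ and $\pi_{(2,0),(0,2)}$ be the projections of the space $\Omega^2(M)_{\mathbb R}$ of smooth real $2$-forms onto the $J$-invariant forms (the real forms of type $(1,1)$, $\alpha(J\cdot,J\cdot)=\alpha$) and onto the $J$-anti-invariant forms (the real forms of type $(2,0)+(0,2)$, $\alpha(J\cdot,J\cdot)=-\alpha$). Let $H^{1,1}_J(M)_{\mathbb R}$ and $H^{(2,0),(0,2)}_J(M)_{\mathbb R}$ be the subspaces of $H^2(M,\mathbb R)$ that consist of the classes of closed forms of type $(1,1)$ and of type $(2,0)+(0,2)$, respectively. Assume that $J$ is $\mathcal C^\infty$ pure and full, i.e. $$H^2(M,\mathbb R)=H^{1,1}_J(M)_{\mathbb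 R}\oplus H^{(2,0),(0,2)}_J(M)_{\mathbb R}.$$ Let $\mathcal B^2$ be the space of exact $2$-forms on $M$ and $\mathcal Z^2_{inv}$ the space of closed left-invariant $2$-forms on $M$ (the closed $2$-forms on $M$ whose pullback to $G$ is left-invariant). For subspaces $A,B$ of $\Omega^2(M)_{\mathbb R}$ write $A/B$ for the image of $A$ in $\Omega^2(M)_{\mathbb R}/B$, i.e. $A/B=(A+B)/B\cong A/(A\cap B)$. Then there are isomorphisms of real vector spaces $$H^{1,1}_J(M)_{\mathbb R}\cong\frac{\pi_{1,1}\mathcal Z^2_{inv}}{\pi_{1,1}\mathcal B^2},\qquad H^{(2,0),(0,2)}_J(M)_{\mathbb R}\cong\frac{\pi_{(2,0),(0,2)}\mathcal Z^2_{inv}}{\pi_{(2,0),(0,2)}\mathcal B^2},$$ and they are the natural ones: the class $[\alpha]$ of a closed form $\alpha$ of type $(1,1)$ (respectively of type $(2,0)+(0,2)$) is mapped to the class of $\alpha$ modulo $\pi_{1,1}\mathcal B^2$ (respectively modulo $\pi_{(2,0),(0,2)}\mathcal B^2$). -/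

import Mathlib

open scoped Manifold ContDiff Topology

noncomputable section

section Forms

variable {E : Type*} [NormedAddCommGroup E] [NormedSpace ℝ E]

/-- The pullback of an alternating form depends smoothly on the form and on the linear map. -/
theorem ContDiffOn.alternatingPullback {D : Type*} [NormedAddCommGroup D] [NormedSpace ℝ D]
    {k : ℕ} {a : D → E [⋀^Fin k]→L[ℝ] ℝ} {f : D → E →L[ℝ] E} {s : Set D} {n : ℕ∞ω}
    (ha : ContDiffOn ℝ n a s) (hf : ContDiffOn ℝ n f s) :
    ContDiffOn ℝ n (fun y => (a y).compContinuousLinearMap (f y)) s := by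
  let A : ContinuousMultilinearMap ℝ (fun _ : Fin k => E) ℝ →L[ℝ] E [⋀^Fin k]→L[ℝ] ℝ :=
    LinearMap.mkContinuous
      { toFun := fun m => ContinuousMultilinearMap.alternatization m
        map_add' := fun m m' => map_add _ m m'
        map_smul' := fun c m => by
          ext v
          change ContinuousMultilinearMap.alternatization (c • m) v =
            c * ContinuousMultilinearMap.alternatization m v
          simp only [ContinuousMultilinearMap.alternatization_apply_apply, Finset.mul_sum,
            smul_apply, smul_eq_mul, mul_smul_comm] }
      (k.factorial : ℝ) (fun m => by
        refine ContinuousAlternatingMap.opNorm_le_bound _ (by positivity) fun v => ?_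
        simp only [LinearMap.coe_mk, AddHom.coe_mk,
          ContinuousMultilinearMap.alternatization_apply_apply]
        refine (norm_sum_le _ _).trans ?_
        have h : ∀ σ : Equiv.Perm (Fin k),
            ‖Equiv.Perm.sign σ • m (v ∘ σ)‖ ≤ ‖m‖ * ∏ i, ‖v i‖ := by
          intro σ
          have h1 : ‖Equiv.Perm.sign σ • m (v ∘ σ)‖ = ‖m (v ∘ σ)‖ := by
            rcases Int.units_eq_one_or (Equiv.Perm.sign σ) with h | h <;> simp [h]
          rw [h1]
          refine (m.le_opNorm _).trans (le_of_eq ?_)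
          congr 1
          exact Equiv.prod_comp σ (fun i => ‖v i‖)
        refine (Finset.sum_le_sum fun σ _ => h σ).trans (le_of_eq ?_)
        simp [Finset.card_univ, Fintype.card_perm, mul_assoc])
  have hk : (k.factorial : ℝ) ≠ 0 := by positivity
  have hA : ∀ b : E [⋀^Fin k]→L[ℝ] ℝ,
      b = (k.factorial : ℝ)⁻¹ • A b.toContinuousMultilinearMap := by
    intro b
    ext v
    have : (A b.toContinuousMultilinearMap) v = (k.factorial : ℝ) * b v := by
      change ContinuousMultilinearMap.alternatization _ v = _
      rw [ContinuousMultilinearMap.alternatization_apply_apply]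
      have h : ∀ σ : Equiv.Perm (Fin k),
          Equiv.Perm.sign σ • b.toContinuousMultilinearMap (v ∘ σ) = b v := by
        intro σ
        have := b.toAlternatingMap.map_perm v σ
        have h2 : b (v ∘ σ) = Equiv.Perm.sign σ • b v := this
        change Equiv.Perm.sign σ • b (v ∘ σ) = b v
        rw [h2, smul_smul, Int.units_mul_self, one_smul]
      simp only [h]
      simp [Finset.card_univ, Fintype.card_perm]
    simp [this, hk]
  have key : (fun y => (a y).compContinuousLinearMap (f y)) = fun y =>
      (k.factorial : ℝ)⁻¹ • A
        ((ContinuousMultilinearMap.compContinuousLinearMapContinuousMultilinear ℝ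
          (fun _ : Fin k => E) (fun _ : Fin k => E) ℝ (fun _ => f y))
          (ContinuousAlternatingMap.toContinuousMultilinearMapCLM ℝ (a y))) := by
    funext y
    exact hA _
  rw [key]
  refine ContDiffOn.const_smul _ (A.contDiff.comp_contDiffOn ?_)
  refine ContDiffOn.clm_apply ?_ ?_
  · exact (ContinuousMultilinearMap.contDiff _).comp_contDiffOn
      (contDiffOn_pi.2 fun _ => hf)
  · exact (ContinuousLinearMap.contDiff _).comp_contDiffOn ha

variable {M : Type*} [TopologicalSpace M] [ChartedSpace E M]
variable {N : Type*} [TopologicalSpace N] [ChartedSpace E N]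

variable (E M) in
/-- A (not necessarily smooth) real differential `k`-form on `M`, a manifold modelled on `E`. -/
abbrev FormField (k : ℕ) : Type _ :=
  ∀ x : M, TangentSpace 𝓘(ℝ, E) x [⋀^Fin k]→L[ℝ] ℝ

/-- The pullback `f^* α` of a form along a map `f : N → M`. -/
def FormField.pullback {k : ℕ} (f : N → M) (α : FormField E M k) : FormField E N k :=
  fun y => (α (f y)).compContinuousLinearMap (mfderiv 𝓘(ℝ, E) 𝓘(ℝ, E) f y)

/-- The expression of a form in the preferred chart around `c`, i.e. its pullback along the inverse
of the chart (meaningful on the target of the chart). -/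
def FormField.inChart {k : ℕ} (α : FormField E M k) (c : M) : E → E [⋀^Fin k]→L[ℝ] ℝ :=
  FormField.pullback (N := E) (chartAt E c).symm α

variable (E M) in
/-- The real vector space of `C^∞` real `k`-forms on `M`. -/
def smoothForms (k : ℕ) : Submodule ℝ (FormField E M k) where
  carrier := {α | ∀ c : M, ContDiffOn ℝ ∞ (α.inChart c) (chartAt E c).target}
  add_mem' hα hβ c := (hα c).add (hβ c)
  zero_mem' _ := contDiffOn_const (c := (0 : E [⋀^Fin k]→L[ℝ] ℝ))
  smul_mem' r _ hα c := (hα c).const_smul r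

/-- The exterior derivative of a form, computed at `x` in the preferred chart around `x`. -/
def FormField.d {k : ℕ} (α : FormField E M k) : FormField E M (k + 1) :=
  fun x => FormField.pullback (M := E) (chartAt E x) (extDeriv (α.inChart x)) x

theorem FormField.pullback_comp {P : Type*} [TopologicalSpace P] [ChartedSpace E P] {k : ℕ}
    (f : N → M) (g : P → N) (α : FormField E M k) (z : P)
    (hf : MDifferentiableAt 𝓘(ℝ, E) 𝓘(ℝ, E) f (g z))
    (hg : MDifferentiableAt 𝓘(ℝ, E) 𝓘(ℝ, E) g z) :
    FormField.pullback (f ∘ g) α z = FormField.pullback g (FormField.pullback f α) z := by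
  unfold FormField.pullback
  rw [mfderiv_comp z hf hg]
  rfl

theorem FormField.pullback_congr {k : ℕ} {f g : N → M} (α : FormField E M k) {z : N}
    (h : f =ᶠ[𝓝 z] g) : FormField.pullback f α z = FormField.pullback g α z := by
  have h1 : f z = g z := h.self_of_nhds
  have h2 := h.mfderiv_eq (I := 𝓘(ℝ, E)) (I' := 𝓘(ℝ, E))
  have key : ∀ (p q : M) (A B : E →L[ℝ] E), p = q → A = B →
      ContinuousAlternatingMap.compContinuousLinearMap (M' := E) (α p : E [⋀^Fin k]→L[ℝ] ℝ) A =
      ContinuousAlternatingMap.compContinuousLinearMap (M' := E) (α q : E [⋀^Fin k]→L[ℝ] ℝ) B := by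
    rintro p q A B rfl rfl; rfl
  exact key (f z) (g z) (mfderiv 𝓘(ℝ, E) 𝓘(ℝ, E) f z) (mfderiv 𝓘(ℝ, E) 𝓘(ℝ, E) g z) h1 h2

variable [IsManifold 𝓘(ℝ, E) ∞ M]

/-- The exterior derivative may be computed in any preferred chart. -/
theorem FormField.inChart_d {k : ℕ} {α : FormField E M k} (hα : α ∈ smoothForms E M k)
    (c : M) {y : E} (hy : y ∈ (chartAt E c).target) :
    α.d.inChart c y = extDeriv (α.inChart c) y := by
  have : IsManifold 𝓘(ℝ, E) 1 M := inferInstance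
  set x := (chartAt E c).symm y with hx
  set φ := chartAt E c
  set ψ := chartAt E x with hψ
  have hxψ : x ∈ ψ.source := mem_chart_source E x
  have hdφ := mdifferentiable_chart (I := 𝓘(ℝ, E)) c
  have hdψ := mdifferentiable_chart (I := 𝓘(ℝ, E)) x
  have hτ : ContDiffOn ℝ ∞ (ψ ∘ φ.symm) (φ.symm.trans ψ).source := by
    have := contDiffOn_ext_coord_change (I := 𝓘(ℝ, E)) (n := ∞) x c
    simpa [extChartAt, φ, ψ] using this
  have hopen : IsOpen (φ.symm.trans ψ).source := (φ.symm.trans ψ).open_source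
  have hyτ : y ∈ (φ.symm.trans ψ).source := by
    simp only [OpenPartialHomeomorph.trans_source, OpenPartialHomeomorph.symm_source]
    exact ⟨hy, hxψ⟩
  have hτat : ContDiffAt ℝ ∞ (ψ ∘ φ.symm) y := hτ.contDiffAt (hopen.mem_nhds hyτ)
  have hform : α.inChart c =ᶠ[𝓝 y] fun z =>
      (α.inChart x ((ψ ∘ φ.symm) z)).compContinuousLinearMap (fderiv ℝ (ψ ∘ φ.symm) z) := by
    filter_upwards [hopen.mem_nhds hyτ] with z hz
    simp only [OpenPartialHomeomorph.trans_source, OpenPartialHomeomorph.symm_source] at hz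
    have hz1 : z ∈ φ.target := hz.1
    have hz2 : φ.symm z ∈ ψ.source := hz.2
    have e1 : (φ.symm : E → M) =ᶠ[𝓝 z] ψ.symm ∘ (ψ ∘ φ.symm) := by
      filter_upwards [hopen.mem_nhds hz] with w hw
      exact (ψ.left_inv hw.2).symm
    have d1 : MDifferentiableAt 𝓘(ℝ, E) 𝓘(ℝ, E) (ψ ∘ φ.symm) z :=
      (hdψ.mdifferentiableAt hz2).comp z (hdφ.mdifferentiableAt_symm hz1)
    have d2 : MDifferentiableAt 𝓘(ℝ, E) 𝓘(ℝ, E) ψ.symm ((ψ ∘ φ.symm) z) :=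
      hdψ.mdifferentiableAt_symm (ψ.map_source hz2)
    have e2 := FormField.pullback_congr α e1
    rw [FormField.pullback_comp _ _ _ _ d2 d1] at e2
    refine e2.trans ?_
    rw [← mfderiv_eq_fderiv]
    rfl
  rw [hform.extDeriv_eq, extDeriv_pullback (r := ∞)]
  · let A : E →L[ℝ] E := mfderiv 𝓘(ℝ, E) 𝓘(ℝ, E) ψ x
    let B : E →L[ℝ] E := mfderiv 𝓘(ℝ, E) 𝓘(ℝ, E) φ.symm y
    have e : fderiv ℝ (ψ ∘ φ.symm) y = A.comp B := by
      rw [← mfderiv_eq_fderiv]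
      exact mfderiv_comp y (hdψ.mdifferentiableAt hxψ) (hdφ.mdifferentiableAt_symm hy)
    rw [e]
    rfl
  · exact ((hα x).contDiffAt (ψ.open_target.mem_nhds (ψ.map_source hxψ))).differentiableAt (by simp)
  · exact hτat
  · simpa using (ENat.LEInfty.out : (2 : ℕ∞ω) ≤ ∞)

theorem FormField.d_mem_smoothForms {k : ℕ} {α : FormField E M k} (hα : α ∈ smoothForms E M k) :
    α.d ∈ smoothForms E M (k + 1) := by
  intro c
  have h : ContDiffOn ℝ ∞ (extDeriv (α.inChart c)) (chartAt E c).target := by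
    have h1 := (hα c).fderiv_of_isOpen (m := ∞) (chartAt E c).open_target (by simp)
    exact (ContinuousAlternatingMap.alternatizeUncurryFinCLM ℝ E ℝ).contDiff.comp_contDiffOn h1
  exact h.congr fun y hy => FormField.inChart_d hα c hy

variable (E M) in
/-- The type `Ω^k(M)_ℝ` of `C^∞` real `k`-forms on `M`. -/
def SmoothForm (k : ℕ) : Type _ := smoothForms E M k

instance (k : ℕ) : AddCommGroup (SmoothForm E M k) :=
  inferInstanceAs (AddCommGroup (smoothForms E M k))

instance (k : ℕ) : Module ℝ (SmoothForm E M k) :=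
  inferInstanceAs (Module ℝ (smoothForms E M k))

variable (E M) in
/-- The exterior derivative `d : Ω^k(M) → Ω^{k+1}(M)` on smooth real forms. -/
def extDerivForms (k : ℕ) : SmoothForm E M k →ₗ[ℝ] SmoothForm E M (k + 1) where
  toFun α := ⟨FormField.d α.1, FormField.d_mem_smoothForms α.2⟩
  map_add' α β := by
    have hd : ∀ (γ : SmoothForm E M k) (x : M),
        DifferentiableAt ℝ (γ.1.inChart x) (chartAt E x x) := fun γ x =>
      ((γ.2 x).contDiffAt ((chartAt E x).open_target.mem_nhds
        (mem_chart_target E x))).differentiableAt (by simp)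
    refine Subtype.ext (funext fun x => ?_)
    have h := extDeriv_add (hd α x) (hd β x)
    change (extDeriv (α.1.inChart x + β.1.inChart x) (chartAt E x x)).compContinuousLinearMap
        (mfderiv 𝓘(ℝ, E) 𝓘(ℝ, E) (chartAt E x) x) = _
    rw [h]
    rfl
  map_smul' r α := by
    refine Subtype.ext (funext fun x => ?_)
    change (extDeriv (r • α.1.inChart x) (chartAt E x x)).compContinuousLinearMap
        (mfderiv 𝓘(ℝ, E) 𝓘(ℝ, E) (chartAt E x) x) = _
    rw [extDeriv_smul]
    rfl

/-- The expression in the preferred chart around `c` of a field of endomorphisms of the tangent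
spaces. -/
def endoInChart (A : ∀ x : M, TangentSpace 𝓘(ℝ, E) x →L[ℝ] TangentSpace 𝓘(ℝ, E) x) (c : M)
    (y : E) : E →L[ℝ] E :=
  (mfderiv 𝓘(ℝ, E) 𝓘(ℝ, E) (chartAt E c) ((chartAt E c).symm y)).comp
    ((A ((chartAt E c).symm y)).comp (mfderiv 𝓘(ℝ, E) 𝓘(ℝ, E) (chartAt E c).symm y))

variable (E M) in
/-- The space `Z²` of closed 2-forms. -/
def closedForms2 : Submodule ℝ (SmoothForm E M 2) := LinearMap.ker (extDerivForms E M 2)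

variable (E M) in
/-- The space `B²` of exact 2-forms. -/
def exactForms2 : Submodule ℝ (SmoothForm E M 2) := LinearMap.range (extDerivForms E M 1)

variable (E M) in
/-- The de Rham cohomology `H²(M, ℝ) = Z² / B²`. -/
abbrev DeRhamH2 : Type _ := closedForms2 E M ⧸ (exactForms2 E M).submoduleOf (closedForms2 E M)

variable (E M) in
/-- The de Rham class of a closed 2-form. -/
def deRhamClass : closedForms2 E M →ₗ[ℝ] DeRhamH2 E M :=
  ((exactForms2 E M).submoduleOf (closedForms2 E M)).mkQ

variable (E M) in
/-- A smooth almost complex structure: a smooth field `J` of endomorphisms of the tangent spaces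
with `J² = -1`. -/
structure AlmostComplexStructure where
  toFun : ∀ x : M, TangentSpace 𝓘(ℝ, E) x →L[ℝ] TangentSpace 𝓘(ℝ, E) x
  sq : ∀ (x : M) (v : TangentSpace 𝓘(ℝ, E) x), toFun x (toFun x v) = -v
  smooth : ∀ c : M, ContDiffOn ℝ ∞ (endoInChart toFun c) (chartAt E c).target

namespace AlmostComplexStructure

variable (J : AlmostComplexStructure E M)

/-- The action of `J` on 2-forms: `(J α)(u, v) = α(J u, J v)`. -/
def act : SmoothForm E M 2 →ₗ[ℝ] SmoothForm E M 2 where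
  toFun α := ⟨fun x => (α.1 x).compContinuousLinearMap (J.toFun x), by
    intro c
    refine ((α.2 c).alternatingPullback (J.smooth c)).congr fun y hy => ?_
    have : IsManifold 𝓘(ℝ, E) 1 M := inferInstance
    have h := (mdifferentiable_chart (I := 𝓘(ℝ, E)) c).symm_comp_deriv
      ((chartAt E c).map_target hy)
    rw [(chartAt E c).right_inv hy] at h
    ext v
    refine congrArg (α.1 ((chartAt E c).symm y)) (funext fun i => ?_)
    exact (DFunLike.congr_fun h (J.toFun ((chartAt E c).symm y)
      (mfderiv 𝓘(ℝ, E) 𝓘(ℝ, E) (chartAt E c).symm y (v i)))).symm⟩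
  map_add' _ _ := rfl
  map_smul' _ _ := rfl

/-- The real 2-forms of type `(1,1)`, i.e. the `J`-invariant ones: `α(J u, J v) = α(u, v)`. -/
def forms11 : Submodule ℝ (SmoothForm E M 2) :=
  LinearMap.eqLocus J.act LinearMap.id

/-- The real 2-forms of type `(2,0) + (0,2)`, i.e. the `J`-anti-invariant ones:
`α(J u, J v) = -α(u, v)`. -/
def forms20 : Submodule ℝ (SmoothForm E M 2) :=
  LinearMap.eqLocus J.act (-LinearMap.id)

/-- The projection `π_{1,1}` of real 2-forms onto those of type `(1,1)`. -/
def proj11 : SmoothForm E M 2 →ₗ[ℝ] SmoothForm E M 2 :=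
  (2⁻¹ : ℝ) • ((LinearMap.id : SmoothForm E M 2 →ₗ[ℝ] SmoothForm E M 2) + J.act)

/-- The projection `π_{(2,0),(0,2)}` of real 2-forms onto those of type `(2,0) + (0,2)`. -/
def proj20 : SmoothForm E M 2 →ₗ[ℝ] SmoothForm E M 2 :=
  (2⁻¹ : ℝ) • ((LinearMap.id : SmoothForm E M 2 →ₗ[ℝ] SmoothForm E M 2) - J.act)

/-- `H^{1,1}_J(M)_ℝ`: the classes in `H²(M, ℝ)` of the closed real forms of type `(1,1)`. -/
def H11 : Submodule ℝ (DeRhamH2 E M) :=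
  (J.forms11.submoduleOf (closedForms2 E M)).map (deRhamClass E M)

/-- `H^{(2,0),(0,2)}_J(M)_ℝ`: the classes in `H²(M, ℝ)` of the closed real forms of type
`(2,0) + (0,2)`. -/
def H20 : Submodule ℝ (DeRhamH2 E M) :=
  (J.forms20.submoduleOf (closedForms2 E M)).map (deRhamClass E M)

/-- `J` is `C^∞` pure and full: `H²(M, ℝ) = H^{1,1}_J(M)_ℝ ⊕ H^{(2,0),(0,2)}_J(M)_ℝ`. -/
def IsPureAndFull : Prop := IsCompl J.H11 J.H20

end AlmostComplexStructure

end Forms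

section Quotient

variable {E : Type*} [NormedAddCommGroup E] [NormedSpace ℝ E]
variable {G : Type*} [Group G]

/-- The left quotient `Γ \ G`: the space of orbits of `Γ` acting on `G` by left multiplication. -/
def LieQuotient (Γ : Subgroup G) : Type _ := MulAction.orbitRel.Quotient Γ G

namespace LieQuotient

variable (Γ : Subgroup G)

/-- The canonical projection `G → Γ \ G`. -/
def proj : G → LieQuotient Γ := Quotient.mk (MulAction.orbitRel Γ G)

theorem proj_surjective : Function.Surjective (proj Γ) := Quotient.mk_surjective

theorem proj_eq_iff {g h : G} : proj Γ g = proj Γ h ↔ ∃ γ ∈ Γ, γ * h = g := by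
  refine (Quotient.eq (r := MulAction.orbitRel Γ G)).trans ?_
  rw [MulAction.orbitRel_apply, MulAction.mem_orbit_iff]
  exact ⟨fun ⟨γ, h⟩ => ⟨γ.1, γ.2, h⟩, fun ⟨γ, h, h'⟩ => ⟨⟨γ, h⟩, h'⟩⟩

variable [TopologicalSpace G]

/-- The quotient topology. -/
instance : TopologicalSpace (LieQuotient Γ) :=
  inferInstanceAs (TopologicalSpace (Quotient (MulAction.orbitRel Γ G)))

theorem isLocalHomeomorph_proj [IsTopologicalGroup G] [DiscreteTopology Γ] :
    IsLocalHomeomorph (proj Γ) := by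
  have hq : Topology.IsQuotientMap (proj Γ) := isQuotientMap_quot_mk
  refine (hq.isQuotientCoveringMap_of_subgroup Γ ?_ ?_).isCoveringMap.isLocalHomeomorph
  · exact isDiscrete_iff_discreteTopology.mpr inferInstance
  · intro g h
    rw [proj_eq_iff]
    constructor
    · rintro ⟨γ, hγ, rfl⟩
      simpa using hγ
    · intro h'
      exact ⟨g * h⁻¹, by simpa using inv_mem h', by simp⟩

variable [ChartedSpace E G] [LieGroup 𝓘(ℝ, E) ∞ G] [DiscreteTopology Γ]

/-- The manifold structure on `Γ \ G`, for `Γ` discrete: the charts are the charts of `G` composed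
with local inverses of the projection, which is a covering map. -/
instance : ChartedSpace E (LieQuotient Γ) :=
  have : IsTopologicalGroup G := topologicalGroup_of_lieGroup 𝓘(ℝ, E) ∞
  (isLocalHomeomorph_proj Γ).chartedSpace (proj_surjective Γ)

instance : IsManifold 𝓘(ℝ, E) ∞ (LieQuotient Γ) := by
  have : IsTopologicalGroup G := topologicalGroup_of_lieGroup 𝓘(ℝ, E) ∞
  have hp := isLocalHomeomorph_proj Γ
  refine isManifold_of_contDiffOn _ _ _ ?_
  have main : ∀ a b : G, ContDiffOn ℝ ∞
      (((hp.localInverseAt a).trans (chartAt E a)).symm.trans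
        ((hp.localInverseAt b).trans (chartAt E b)))
      (((hp.localInverseAt a).trans (chartAt E a)).symm.trans
        ((hp.localInverseAt b).trans (chartAt E b))).source := by
    intro a b z hz
    apply ContDiffAt.contDiffWithinAt
    set w := (chartAt E a).symm z with hw
    have hsymm : ∀ c : G, ∀ g, (hp.localInverseAt c).symm g = proj Γ g := fun c g =>
      congrFun (hp.localInverseAt_symm c) g
    have hza : z ∈ (chartAt E a).target := by
      simp at hz; tauto
    have hb1 : proj Γ w ∈ (hp.localInverseAt b).source := by
      simp at hz; tauto
    have hb2 : hp.localInverseAt b (proj Γ w) ∈ (chartAt E b).source := by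
      simp at hz; tauto
    obtain ⟨γ, hγ, hγw⟩ := (proj_eq_iff Γ).1 (hp.apply_localInverseAt_of_mem hb1)
    have e : (((hp.localInverseAt a).trans (chartAt E a)).symm.trans
        ((hp.localInverseAt b).trans (chartAt E b))) =ᶠ[𝓝 z]
        (chartAt E b) ∘ (fun g => γ * g) ∘ (chartAt E a).symm := by
      have hc : ContinuousAt (fun y => γ * (chartAt E a).symm y) z :=
        continuousAt_const.mul ((chartAt E a).continuousAt_symm hza)
      have ht : (hp.localInverseAt b).target ∈ 𝓝 (γ * (chartAt E a).symm z) := by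
        refine (hp.localInverseAt b).open_target.mem_nhds ?_
        rw [← hw, hγw]
        exact (hp.localInverseAt b).map_source hb1
      filter_upwards [hc ht] with y hy
      have h1 := (hp.localInverseAt b).right_inv hy
      rw [hsymm] at h1
      have h2 : proj Γ (γ * (chartAt E a).symm y) = proj Γ ((chartAt E a).symm y) :=
        (proj_eq_iff Γ).2 ⟨γ, hγ, rfl⟩
      rw [h2] at h1
      simp [h1]
    refine ContDiffAt.congr_of_eventuallyEq ?_ e
    rw [← contMDiffAt_iff_contDiffAt]
    have m1 : ContMDiffAt 𝓘(ℝ, E) 𝓘(ℝ, E) ∞ (chartAt E a).symm z :=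
      (contMDiffOn_chart_symm z hza).contMDiffAt ((chartAt E a).open_target.mem_nhds hza)
    have m2 : ContMDiffAt 𝓘(ℝ, E) 𝓘(ℝ, E) ∞ (fun g => γ * g) ((chartAt E a).symm z) :=
      contMDiff_mul_left.contMDiffAt
    have m3 : ContMDiffAt 𝓘(ℝ, E) 𝓘(ℝ, E) ∞ (chartAt E b) (γ * (chartAt E a).symm z) := by
      rw [← hw, hγw]
      exact (contMDiffOn_chart _ hb2).contMDiffAt ((chartAt E b).open_source.mem_nhds hb2)
    exact ContMDiffAt.comp (g := chartAt E b) z m3 (ContMDiffAt.comp (g := fun g => γ * g) z m2 m1)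
  rintro _ _ ⟨q, rfl⟩ ⟨q', rfl⟩
  simpa using main _ _

variable (E) in
/-- The closed left-invariant 2-forms `Z²_inv` on `Γ \ G`: the closed 2-forms whose pullback to `G`
is invariant under all left translations of `G`. -/
def closedInvariantForms2 :
    Submodule ℝ (SmoothForm E (LieQuotient Γ) 2) where
  carrier := {α | α ∈ closedForms2 E (LieQuotient Γ) ∧ ∀ h : G,
    FormField.pullback (E := E) (fun g : G => h * g) (FormField.pullback (proj Γ) α.1) =
      FormField.pullback (proj Γ) α.1}
  add_mem' hα hβ := ⟨add_mem hα.1 hβ.1, fun h =>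
    congrArg₂ (fun a b : FormField E G 2 => a + b) (hα.2 h) (hβ.2 h)⟩
  zero_mem' := ⟨zero_mem _, fun _ => rfl⟩
  smul_mem' r _ hα := ⟨Submodule.smul_mem _ r hα.1, fun h =>
    congrArg (fun a : FormField E G 2 => r • a) (hα.2 h)⟩

end LieQuotient

end Quotient

section ChevalleyEilenberg

/-- With this, the Lie algebra structure on the tangent space at `1` of a `C^∞` Lie group is found by
instance search. -/
instance : ENat.LEInfty (minSmoothness ℝ 3) :=
  ⟨by simpa using (ENat.LEInfty.out : (3 : ℕ∞ω) ≤ ∞)⟩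

/-- The real line, regarded as a trivial module over every Lie algebra. -/
def TrivialReal : Type := ℝ

instance : AddCommGroup TrivialReal := inferInstanceAs (AddCommGroup ℝ)

instance : Module ℝ TrivialReal := inferInstanceAs (Module ℝ ℝ)

instance (L : Type*) [LieRing L] : LieRingModule L TrivialReal where
  bracket _ _ := 0
  add_lie _ _ _ := (add_zero 0).symm
  lie_add _ _ _ := (add_zero 0).symm
  leibniz_lie _ _ _ := (add_zero 0).symm

instance (L : Type*) [LieRing L] [LieAlgebra ℝ L] : LieModule ℝ L TrivialReal where
  smul_lie t _ _ := (smul_zero t).symm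
  lie_smul t _ _ := (smul_zero t).symm

instance (L : Type*) [LieRing L] : LieModule.IsTrivial L TrivialReal := ⟨fun _ _ => rfl⟩

/-- The alternating bilinear forms on `L`, i.e. the Chevalley-Eilenberg 2-cochains with trivial real
coefficients. -/
def CECochain2 (L : Type*) [LieRing L] [LieAlgebra ℝ L] : Type _ :=
  LieModule.Cohomology.twoCochain ℝ L TrivialReal

variable (L : Type*) [LieRing L] [LieAlgebra ℝ L]

instance : AddCommGroup (CECochain2 L) :=
  inferInstanceAs (AddCommGroup (LieModule.Cohomology.twoCochain ℝ L TrivialReal))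

instance : Module ℝ (CECochain2 L) :=
  inferInstanceAs (Module ℝ (LieModule.Cohomology.twoCochain ℝ L TrivialReal))

/-- The Chevalley-Eilenberg 2-cocycles of `L` with trivial real coefficients. -/
def ceCocycles2 : Submodule ℝ (CECochain2 L) :=
  LieModule.Cohomology.twoCocycle ℝ L TrivialReal

/-- The Chevalley-Eilenberg 2-coboundaries of `L` with trivial real coefficients. -/
def ceCoboundaries2 : Submodule ℝ (CECochain2 L) :=
  LinearMap.range (LieModule.Cohomology.d₁₂ ℝ L TrivialReal)

/-- The Chevalley-Eilenberg cohomology `H²(L)` with trivial real coefficients. -/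
abbrev ChevalleyEilenbergH2 : Type _ :=
  ceCocycles2 L ⧸ (ceCoboundaries2 L).submoduleOf (ceCocycles2 L)

end ChevalleyEilenberg

/-- The quotient `A / B` of two subspaces of `V`, where `B` need not be contained in `A`: the space
of the classes modulo `B` of the elements of `A`, which is `(A + B) / B ≅ A / (A ∩ B)`. -/
def classesModulo {V : Type*} [AddCommGroup V] [Module ℝ V] (A B : Submodule ℝ V) :
    Submodule ℝ (V ⧸ B) :=
  A.map B.mkQ

end

/-! The heart of the matter is that every closed 2-form on `M = Γ \ G` is an invariant closed form
plus an exact one (`closedForms2_le_sup`). The hypothesis gives only some isomorphism between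
`H²(M)` and `H²(𝔤)`, so it can be used only to compare dimensions. The natural map from cocycles on
`𝔤` to `H²(M)` must be shown to kill nothing but coboundaries; since the spaces are
finite-dimensional, it is then onto.

Injectivity comes from averaging (`mem_ceCoboundaries2_of_d_eq`). A form on `M` is described by its
coefficients in the left-invariant frame, which are `Γ`-invariant functions on `G`, and `coeff_d`
expresses `d` through derivatives along left-invariant fields and structure constants. If `dβ` is
the invariant form of a cochain `c`, average the coefficients of the 1-form `β` over a fundamental
set of `Γ`. The derivative terms integrate to zero, because integration of `Γ`-invariant functions
is invariant under right translations: `G` is unimodular, having a uniform discrete subgroup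
(`exists_measure_right_invariant`). What remains says that `c` is the coboundary of the averaged
1-form. No exponential map is needed: any curve through `1` with the right velocity computes the
derivative.

The rest is linear algebra (`exists_equiv_classesModulo`). The closed forms of one type surject onto
their cohomology classes and also map to the quotient of the projected invariant forms. Fullness,
together with the decomposition above, makes the second map surjective, and purity makes the two
kernels equal. -/

noncomputable section

/-! ### Pullback of forms along maps from the model space, and its compatibility with `d`. -/

section Forms

variable {E : Type*} [NormedAddCommGroup E] [NormedSpace ℝ E]
variable {M : Type*} [TopologicalSpace M] [ChartedSpace E M]

/-- The pullback of a form along a map from the model space, as a function between vector spaces. -/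
def FormField.onModel {k : ℕ} (f : E → M) (α : FormField E M k) : E → E [⋀^Fin k]→L[ℝ] ℝ :=
  FormField.pullback f α

variable [IsManifold 𝓘(ℝ, E) ∞ M]

/-- The pullback of a form along `f : E → M` is the pullback along `φ ∘ f` of its expression in the
preferred chart `φ` around `c`, wherever this makes sense. -/
theorem FormField.onModel_eqOn_inChart {k : ℕ} (α : FormField E M k) {f : E → M}
    {s : Set E} (hs : IsOpen s) (hf : ContMDiffOn 𝓘(ℝ, E) 𝓘(ℝ, E) ∞ f s) (c : M) :
    IsOpen (s ∩ f ⁻¹' (chartAt E c).source) ∧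
    ContDiffOn ℝ ∞ (chartAt E c ∘ f) (s ∩ f ⁻¹' (chartAt E c).source) ∧
    ∀ z ∈ s ∩ f ⁻¹' (chartAt E c).source, FormField.onModel f α z =
      (α.inChart c ((chartAt E c ∘ f) z)).compContinuousLinearMap
        (fderiv ℝ (chartAt E c ∘ f) z) := by
  have : IsManifold 𝓘(ℝ, E) 1 M := inferInstance
  set ψ := chartAt E c with hψ
  have hdψ := mdifferentiable_chart (I := 𝓘(ℝ, E)) c
  have hopen : IsOpen (s ∩ f ⁻¹' ψ.source) := hf.continuousOn.isOpen_inter_preimage hs ψ.open_source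
  refine ⟨hopen, ?_, ?_⟩
  · rw [← contMDiffOn_iff_contDiffOn]
    exact (contMDiffOn_chart (I := 𝓘(ℝ, E)) (x := c)).comp (hf.mono Set.inter_subset_left)
      Set.inter_subset_right
  · intro z hz
    have e1 : f =ᶠ[𝓝 z] ψ.symm ∘ (ψ ∘ f) := by
      filter_upwards [hopen.mem_nhds hz] with w hw
      exact (ψ.left_inv hw.2).symm
    have hfz : MDifferentiableAt 𝓘(ℝ, E) 𝓘(ℝ, E) f z :=
      ((hf z hz.1).contMDiffAt (hs.mem_nhds hz.1)).mdifferentiableAt (by simp)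
    have d1 : MDifferentiableAt 𝓘(ℝ, E) 𝓘(ℝ, E) (ψ ∘ f) z :=
      (hdψ.mdifferentiableAt hz.2).comp z hfz
    have d2 : MDifferentiableAt 𝓘(ℝ, E) 𝓘(ℝ, E) ψ.symm ((ψ ∘ f) z) :=
      hdψ.mdifferentiableAt_symm (ψ.map_source hz.2)
    have e2 := FormField.pullback_congr α e1
    rw [FormField.pullback_comp _ _ _ _ d2 d1] at e2
    refine e2.trans ?_
    rw [← mfderiv_eq_fderiv]
    rfl

/-- The pullback of a smooth form along a smooth map from an open subset of the model space is
smooth. -/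
theorem FormField.contDiffOn_onModel {k : ℕ} {α : FormField E M k} (hα : α ∈ smoothForms E M k)
    {f : E → M} {s : Set E} (hs : IsOpen s) (hf : ContMDiffOn 𝓘(ℝ, E) 𝓘(ℝ, E) ∞ f s) :
    ContDiffOn ℝ ∞ (FormField.onModel f α) s := by
  intro y hy
  obtain ⟨h0, h1, h2⟩ := FormField.onModel_eqOn_inChart α hs hf (f y)
  have hy' : y ∈ s ∩ f ⁻¹' (chartAt E (f y)).source := ⟨hy, mem_chart_source E (f y)⟩
  have h3 : ContDiffOn ℝ ∞ (fun z => α.inChart (f y) ((chartAt E (f y) ∘ f) z)) _ :=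
    (hα (f y)).comp h1 fun z hz => (chartAt E (f y)).map_source hz.2
  have h4 := h3.alternatingPullback (h1.fderiv_of_isOpen (m := ∞) h0 (by simp))
  exact ((h4.congr h2).contDiffAt (h0.mem_nhds hy')).contDiffWithinAt

/-- Pullback along a smooth map from an open subset of the model space commutes with the exterior
derivative. -/
theorem FormField.extDeriv_onModel {k : ℕ} {α : FormField E M k} (hα : α ∈ smoothForms E M k)
    {f : E → M} {s : Set E} (hs : IsOpen s) (hf : ContMDiffOn 𝓘(ℝ, E) 𝓘(ℝ, E) ∞ f s) {y : E}
    (hy : y ∈ s) :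
    extDeriv (FormField.onModel f α) y = FormField.onModel f α.d y := by
  obtain ⟨h0, h1', h2'⟩ := FormField.onModel_eqOn_inChart α hs hf (f y)
  have hy' := h0.mem_nhds (⟨hy, mem_chart_source E (f y)⟩ :
    y ∈ s ∩ f ⁻¹' (chartAt E (f y)).source)
  have h1 := h1'.contDiffAt hy'
  have h2 : FormField.onModel f α =ᶠ[𝓝 y] fun z =>
      (α.inChart (f y) ((chartAt E (f y) ∘ f) z)).compContinuousLinearMap
        (fderiv ℝ (chartAt E (f y) ∘ f) z) := Filter.eventuallyEq_of_mem hy' h2'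
  have hdψ := mdifferentiable_chart (I := 𝓘(ℝ, E)) (f y)
  have hm : (chartAt E (f y) ∘ f) y ∈ (chartAt E (f y)).target :=
    (chartAt E (f y)).map_source (mem_chart_source E (f y))
  rw [h2.extDeriv_eq, _root_.extDeriv_pullback (r := ∞)]
  · have hfy : MDifferentiableAt 𝓘(ℝ, E) 𝓘(ℝ, E) f y :=
      ((hf y hy).contMDiffAt (hs.mem_nhds hy)).mdifferentiableAt (by simp)
    let A : E →L[ℝ] E := mfderiv 𝓘(ℝ, E) 𝓘(ℝ, E) (chartAt E (f y)) (f y)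
    let B : E →L[ℝ] E := mfderiv 𝓘(ℝ, E) 𝓘(ℝ, E) f y
    have e : fderiv ℝ (chartAt E (f y) ∘ f) y = A.comp B := by
      rw [← mfderiv_eq_fderiv]
      exact mfderiv_comp y (hdψ.mdifferentiableAt (mem_chart_source E (f y))) hfy
    rw [e]
    rfl
  · exact ((hα (f y)).contDiffAt
      ((chartAt E (f y)).open_target.mem_nhds hm)).differentiableAt (by simp)
  · exact h1
  · simpa using (ENat.LEInfty.out : (2 : ℕ∞ω) ≤ ∞)

end Forms

/-! ### Invertibility of derivatives, and smoothness of left translations. -/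

section

variable {E : Type*} [NormedAddCommGroup E] [NormedSpace ℝ E]
variable {M : Type*} [TopologicalSpace M] [ChartedSpace E M]
variable {N : Type*} [TopologicalSpace N] [ChartedSpace E N]

/-- A map between manifolds of the same finite dimension that has a differentiable local left
inverse has an invertible derivative. -/
theorem mfderiv_isInvertible_of_leftInverse [FiniteDimensional ℝ E] {f : M → N} {g : N → M} {x : M}
    (hf : MDifferentiableAt 𝓘(ℝ, E) 𝓘(ℝ, E) f x) (hg : MDifferentiableAt 𝓘(ℝ, E) 𝓘(ℝ, E) g (f x))
    (h : g ∘ f =ᶠ[𝓝 x] id) :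
    (mfderiv 𝓘(ℝ, E) 𝓘(ℝ, E) f x : E →L[ℝ] E).IsInvertible := by
  have h1 := h.mfderiv_eq (I := 𝓘(ℝ, E)) (I' := 𝓘(ℝ, E))
  rw [mfderiv_comp x hg hf, mfderiv_id] at h1
  let A : E →L[ℝ] E := mfderiv 𝓘(ℝ, E) 𝓘(ℝ, E) f x
  let B : E →L[ℝ] E := mfderiv 𝓘(ℝ, E) 𝓘(ℝ, E) g (f x)
  -- The chain rule gives only a left inverse `B` of `A`; in finite dimension an injective
  -- endomorphism is invertible.
  have hinj : Function.Injective A.toLinearMap :=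
    Function.LeftInverse.injective (g := B) fun v => DFunLike.congr_fun h1 v
  exact ⟨(LinearEquiv.ofInjectiveEndo _ hinj).toContinuousLinearEquiv, rfl⟩

end

section

variable {E : Type*} [NormedAddCommGroup E] [NormedSpace ℝ E]
variable {G : Type*} [Group G] [TopologicalSpace G] [ChartedSpace E G] [LieGroup 𝓘(ℝ, E) ∞ G]

variable (E) in
theorem contMDiff_mul_left_top (g : G) :
    ContMDiff 𝓘(ℝ, E) 𝓘(ℝ, E) ∞ (fun x : G => g * x) :=
  contMDiff_mul_left

variable (E) in
theorem mdifferentiable_mul_left_top (g : G) :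
    MDifferentiable 𝓘(ℝ, E) 𝓘(ℝ, E) (fun x : G => g * x) :=
  (contMDiff_mul_left_top E g).mdifferentiable (by simp)

end

/-! ### The projection `G → Γ \ G` in charts. -/

namespace LieQuotient

variable {E : Type*} [NormedAddCommGroup E] [NormedSpace ℝ E]
variable {G : Type*} [Group G] [TopologicalSpace G] [ChartedSpace E G] [LieGroup 𝓘(ℝ, E) ∞ G]
variable (Γ : Subgroup G) [DiscreteTopology Γ]

variable (E) in
/-- The inverse of a preferred chart of `Γ \ G` is the projection composed with the inverse of a
preferred chart of `G`. -/
theorem exists_chartAt_eq (x : LieQuotient Γ) : ∃ a : G, proj Γ a = x ∧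
    (chartAt E x).target ⊆ (chartAt E a).target ∧
    ((chartAt E x).symm : E → LieQuotient Γ) = proj Γ ∘ (chartAt E a).symm ∧
    chartAt E x ∘ proj Γ =ᶠ[𝓝 a] chartAt E a := by
  have : IsTopologicalGroup G := topologicalGroup_of_lieGroup 𝓘(ℝ, E) ∞
  have hp := isLocalHomeomorph_proj Γ
  -- This is the same choice of preimage as in the construction of the charts of `Γ \ G`, so that
  -- `hc` holds by definition.
  let a := (proj_surjective Γ).hasRightInverse.choose x
  have hr : proj Γ a = x := (proj_surjective Γ).hasRightInverse.choose_spec x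
  have hc : chartAt E x = (hp.localInverseAt a).trans (chartAt E a) := rfl
  have hsymm : ((chartAt E x).symm : E → LieQuotient Γ) = proj Γ ∘ (chartAt E a).symm := by
    rw [hc]
    funext y
    simp
  refine ⟨a, hr, ?_, hsymm, ?_⟩
  · rw [hc]
    intro y hy
    simp at hy
    exact hy.1
  · have ha : chartAt E a a ∈ (chartAt E x).target := by
      rw [hc]
      simp
    have h1 : ∀ᶠ h in 𝓝 a, h ∈ (chartAt E a).source :=
      (chartAt E a).open_source.mem_nhds (mem_chart_source E a)
    have h2 : ∀ᶠ h in 𝓝 a, chartAt E a h ∈ (chartAt E x).target :=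
      ((chartAt E a).continuousAt (mem_chart_source E a)).eventually
        ((chartAt E x).open_target.mem_nhds ha)
    filter_upwards [h1, h2] with h h1 h2
    have h3 := (chartAt E x).right_inv h2
    rw [hsymm] at h3
    simpa [(chartAt E a).left_inv h1] using h3

variable (E) in
theorem contMDiff_proj : ContMDiff 𝓘(ℝ, E) 𝓘(ℝ, E) ∞ (proj Γ) := by
  have : IsTopologicalGroup G := topologicalGroup_of_lieGroup 𝓘(ℝ, E) ∞
  intro g
  obtain ⟨a, ha, -, hs, hc⟩ := exists_chartAt_eq E Γ (proj Γ g)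
  -- The chart around `proj Γ g` is built at a chosen preimage `γ * g` rather than at `g`, so a
  -- neighbourhood of `g` is first moved by `γ`.
  obtain ⟨γ, hγ, rfl⟩ := (proj_eq_iff Γ).1 ha
  have hx : chartAt E (γ * g) (γ * g) ∈ (chartAt E (proj Γ g)).target := by
    rw [← hc.self_of_nhds]
    simp only [Function.comp_apply, ha]
    exact mem_chart_target E _
  have e : proj Γ =ᶠ[𝓝 g] (chartAt E (proj Γ g)).symm ∘ (chartAt E (γ * g) ∘ (fun h => γ * h)) := by
    have h1 : ∀ᶠ h in 𝓝 g, γ * h ∈ (chartAt E (γ * g)).source :=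
      (continuous_const_mul γ).continuousAt.eventually
        ((chartAt E (γ * g)).open_source.mem_nhds (mem_chart_source E (γ * g)))
    filter_upwards [h1] with h h1
    rw [hs]
    simp only [Function.comp_apply, (chartAt E (γ * g)).left_inv h1]
    exact ((proj_eq_iff Γ).2 ⟨γ, hγ, rfl⟩).symm
  refine ContMDiffAt.congr_of_eventuallyEq ?_ e
  have m1 : ContMDiffAt 𝓘(ℝ, E) 𝓘(ℝ, E) ∞ (chartAt E (γ * g)) (γ * g) :=
    (contMDiffOn_chart _ (mem_chart_source E _)).contMDiffAt
      ((chartAt E _).open_source.mem_nhds (mem_chart_source E _))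
  have m2 : ContMDiffAt 𝓘(ℝ, E) 𝓘(ℝ, E) ∞ (chartAt E (proj Γ g)).symm
      (chartAt E (γ * g) (γ * g)) :=
    (contMDiffOn_chart_symm _ hx).contMDiffAt ((chartAt E _).open_target.mem_nhds hx)
  exact ContMDiffAt.comp (g := (chartAt E (proj Γ g)).symm) g m2
    (ContMDiffAt.comp (g := chartAt E (γ * g)) g m1 (contMDiff_mul_left_top E γ g))

variable (E) in
theorem mfderiv_proj_mul_isInvertible [FiniteDimensional ℝ E] (g : G) :
    (mfderiv 𝓘(ℝ, E) 𝓘(ℝ, E) (fun h : G => proj Γ (g * h)) 1 : E →L[ℝ] E).IsInvertible := by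
  have : IsTopologicalGroup G := topologicalGroup_of_lieGroup 𝓘(ℝ, E) ∞
  obtain ⟨a, ha, -, hs, hc⟩ := exists_chartAt_eq E Γ (proj Γ g)
  obtain ⟨γ, hγ, rfl⟩ := (proj_eq_iff Γ).1 ha
  have h0 : proj Γ (g * 1) = proj Γ g := by rw [mul_one]
  have hφ := (mdifferentiable_chart (I := 𝓘(ℝ, E)) (proj Γ g)).mdifferentiableAt
    (mem_chart_source E (proj Γ g))
  have hx : chartAt E (proj Γ g) (proj Γ g) = chartAt E (γ * g) (γ * g) := by
    rw [← hc.self_of_nhds]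
    simp only [Function.comp_apply, ha]
  have hψ : MDifferentiableAt 𝓘(ℝ, E) 𝓘(ℝ, E) (chartAt E (γ * g)).symm
      (chartAt E (proj Γ g) (proj Γ g)) := by
    rw [hx]
    exact (mdifferentiable_chart (I := 𝓘(ℝ, E)) (γ * g)).mdifferentiableAt_symm
      (mem_chart_target E _)
  -- Local left inverse: the two charts combine to a local section of `proj Γ` through `γ * g`, and
  -- a left translation brings `γ * g` back to `1`.
  refine mfderiv_isInvertible_of_leftInverse
    (g := (fun h => (γ * g)⁻¹ * h) ∘ ((chartAt E (γ * g)).symm ∘ chartAt E (proj Γ g))) ?_ ?_ ?_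
  · exact ((contMDiff_proj E Γ).mdifferentiable (by simp) _).comp _
      (mdifferentiable_mul_left_top E g _)
  · rw [h0]
    exact (mdifferentiable_mul_left_top E _ _).comp _ (hψ.comp _ hφ)
  · have hcont : ContinuousAt (fun h => γ * g * h) 1 := (continuous_const_mul (γ * g)).continuousAt
    have ht : Filter.Tendsto (fun h => γ * g * h) (𝓝 1) (𝓝 (γ * g)) := by
      simpa [ContinuousAt] using hcont
    have h1 : ∀ᶠ h in 𝓝 (1 : G), γ * g * h ∈ (chartAt E (γ * g)).source :=
      ht.eventually ((chartAt E (γ * g)).open_source.mem_nhds (mem_chart_source E (γ * g)))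
    filter_upwards [h1, ht.eventually hc] with h h1 h2
    have h3 : proj Γ (g * h) = proj Γ (γ * g * h) :=
      ((proj_eq_iff Γ).2 ⟨γ, hγ, by rw [mul_assoc]⟩).symm
    simp only [Function.comp_apply] at h2 ⊢
    rw [h3, h2, (chartAt E (γ * g)).left_inv h1]
    change (γ * g)⁻¹ * (γ * g * h) = h
    group

end LieQuotient

/-! ### The left-invariant frame in a chart of `G`: smoothness and brackets. -/

section

variable {E : Type*} [NormedAddCommGroup E] [NormedSpace ℝ E]
variable {G : Type*} [Group G] [TopologicalSpace G] [ChartedSpace E G]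

variable (E) in
/-- The left-invariant vector fields on a Lie group, expressed in the preferred chart around `a`. -/
def leftFrame (a : G) (y : E) : E →L[ℝ] E :=
  mfderiv 𝓘(ℝ, E) 𝓘(ℝ, E) (fun h : G => chartAt E a ((chartAt E a).symm y * h)) 1

variable (E G) in
/-- The derivative at `1` of the preferred chart around `1`. -/
def chartDerivOne : E →L[ℝ] E :=
  mfderiv 𝓘(ℝ, E) 𝓘(ℝ, E) (chartAt E (1 : G)) 1

/-- Multiplication in a Lie group, in the preferred charts around `a` and `1`. -/
def chartMul (a : G) (y w : E) : E :=
  chartAt E a ((chartAt E a).symm y * (chartAt E (1 : G)).symm w)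

/-- A curve through `1` with derivative `v` at `0`: a straight line in the preferred chart around
`1`. -/
def curveThroughOne (v : GroupLieAlgebra 𝓘(ℝ, E) G) (t : ℝ) : G :=
  (chartAt E (1 : G)).symm (chartAt E (1 : G) 1 +
    t • chartDerivOne E G v)

theorem curveThroughOne_zero (v : GroupLieAlgebra 𝓘(ℝ, E) G) : curveThroughOne v 0 = 1 := by
  simp [curveThroughOne, (chartAt E (1 : G)).left_inv (mem_chart_source E (1 : G))]

variable [LieGroup 𝓘(ℝ, E) ∞ G]

theorem contMDiffAt_curveThroughOne (v : GroupLieAlgebra 𝓘(ℝ, E) G) :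
    ContMDiffAt 𝓘(ℝ, ℝ) 𝓘(ℝ, E) ∞ (curveThroughOne v) 0 := by
  have h1 : ContMDiffAt 𝓘(ℝ, E) 𝓘(ℝ, E) ∞ (chartAt E (1 : G)).symm
      (chartAt E (1 : G) 1 +
        (0 : ℝ) • chartDerivOne E G v) := by
    have h0 := mem_chart_target E (1 : G)
    have := (contMDiffOn_chart_symm (I := 𝓘(ℝ, E)) (n := ∞) _ h0).contMDiffAt
      ((chartAt E (1 : G)).open_target.mem_nhds h0)
    simpa only [zero_smul, add_zero] using this
  refine ContMDiffAt.comp (0 : ℝ) h1 (ContDiff.contMDiff ?_).contMDiffAt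
  exact contDiff_const.add (contDiff_id.smul contDiff_const)

theorem mdifferentiableAt_chart_mul (a : G) {y : E} (hy : y ∈ (chartAt E a).target) :
    MDifferentiableAt 𝓘(ℝ, E) 𝓘(ℝ, E)
      (fun h : G => chartAt E a ((chartAt E a).symm y * h)) 1 := by
  refine MDifferentiableAt.comp (g := chartAt E a) (1 : G) ?_ (mdifferentiable_mul_left_top E _ _)
  refine (mdifferentiable_chart (I := 𝓘(ℝ, E)) a).mdifferentiableAt ?_
  simpa using (chartAt E a).map_target hy

theorem symm_comp_chart_mul_eventuallyEq (a : G) {y : E} (hy : y ∈ (chartAt E a).target) :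
    (chartAt E a).symm ∘ (fun h : G => chartAt E a ((chartAt E a).symm y * h)) =ᶠ[𝓝 1]
      fun h => (chartAt E a).symm y * h := by
  have : IsTopologicalGroup G := topologicalGroup_of_lieGroup 𝓘(ℝ, E) ∞
  have hc : ContinuousAt (fun h => (chartAt E a).symm y * h) 1 :=
    (continuous_const_mul _).continuousAt
  have h1 : ∀ᶠ h in 𝓝 (1 : G), (chartAt E a).symm y * h ∈ (chartAt E a).source :=
    hc.eventually ((chartAt E a).open_source.mem_nhds (by simpa using (chartAt E a).map_target hy))
  filter_upwards [h1] with h h1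
  exact (chartAt E a).left_inv h1

theorem leftFrame_isInvertible [FiniteDimensional ℝ E] (a : G) {y : E}
    (hy : y ∈ (chartAt E a).target) : (leftFrame E a y).IsInvertible := by
  refine mfderiv_isInvertible_of_leftInverse
    (g := (fun h => ((chartAt E a).symm y)⁻¹ * h) ∘ (chartAt E a).symm)
    (mdifferentiableAt_chart_mul a hy) ?_ ?_
  · simp only [mul_one, (chartAt E a).right_inv hy]
    exact (mdifferentiable_mul_left_top E _ _).comp _
      ((mdifferentiable_chart (I := 𝓘(ℝ, E)) a).mdifferentiableAt_symm hy)
  · filter_upwards [symm_comp_chart_mul_eventuallyEq a hy] with h hh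
    simp only [Function.comp_apply] at hh ⊢
    rw [hh]
    simp

/-- Links the concrete frame in coordinates with the left-invariant vector fields by which the
bracket of the Lie algebra is defined. -/
theorem mfderiv_symm_leftFrame (a : G) {y : E} (hy : y ∈ (chartAt E a).target) (v : E) :
    (mfderiv 𝓘(ℝ, E) 𝓘(ℝ, E) (chartAt E a).symm y : E →L[ℝ] E) (leftFrame E a y v) =
      mulInvariantVectorField (I := 𝓘(ℝ, E)) (v : GroupLieAlgebra 𝓘(ℝ, E) G)
        ((chartAt E a).symm y) := by
  have h := (symm_comp_chart_mul_eventuallyEq a hy).mfderiv_eq (I := 𝓘(ℝ, E)) (I' := 𝓘(ℝ, E))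
  have hyy : chartAt E a ((chartAt E a).symm y * 1) = y := by
    rw [mul_one, (chartAt E a).right_inv hy]
  rw [mfderiv_comp (1 : G) (by
    rw [hyy]
    exact (mdifferentiable_chart (I := 𝓘(ℝ, E)) a).mdifferentiableAt_symm hy)
    (mdifferentiableAt_chart_mul a hy)] at h
  have h2 := DFunLike.congr_fun h v
  -- The chain rule leaves the derivative at `chartAt E a ((chartAt E a).symm y * 1)`. Its type
  -- depends on the point, so the equality with `y` is transported through a free variable.
  have key : ∀ z : E, z = y →
      (mfderiv 𝓘(ℝ, E) 𝓘(ℝ, E) (chartAt E a).symm y : E →L[ℝ] E) (leftFrame E a y v) =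
      (mfderiv 𝓘(ℝ, E) 𝓘(ℝ, E) (chartAt E a).symm z : E →L[ℝ] E) (leftFrame E a y v) := by
    rintro z rfl; rfl
  exact (key _ hyy).trans h2

theorem mpullback_symm_mulInvariantVectorField [FiniteDimensional ℝ E] (a : G) {y : E}
    (hy : y ∈ (chartAt E a).target) (v : GroupLieAlgebra 𝓘(ℝ, E) G) :
    VectorField.mpullback 𝓘(ℝ, E) 𝓘(ℝ, E) (chartAt E a).symm (mulInvariantVectorField v) y =
      leftFrame E a y v := by
  have hinv : (mfderiv 𝓘(ℝ, E) 𝓘(ℝ, E) (chartAt E a).symm y).IsInvertible :=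
    mfderiv_isInvertible_of_leftInverse (g := chartAt E a)
      ((mdifferentiable_chart (I := 𝓘(ℝ, E)) a).mdifferentiableAt_symm hy)
      ((mdifferentiable_chart (I := 𝓘(ℝ, E)) a).mdifferentiableAt ((chartAt E a).map_target hy))
      (by
        filter_upwards [(chartAt E a).open_target.mem_nhds hy] with z hz
        exact (chartAt E a).right_inv hz)
  refine hinv.inverse_apply_eq.2 ?_
  exact (mfderiv_symm_leftFrame a hy v).symm

theorem contDiffAt_chart_mul (a : G) {y : E} (hy : y ∈ (chartAt E a).target) :
    ContDiffAt ℝ ∞ (Function.uncurry (chartMul (E := E) a))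
      (y, chartAt E (1 : G) 1) := by
  rw [← contMDiffAt_iff_contDiffAt]
  have h0 := mem_chart_target E (1 : G)
  have m1 : ContMDiffAt 𝓘(ℝ, E) 𝓘(ℝ, E) ∞ (chartAt E a).symm y :=
    (contMDiffOn_chart_symm _ hy).contMDiffAt ((chartAt E a).open_target.mem_nhds hy)
  have m2 : ContMDiffAt 𝓘(ℝ, E) 𝓘(ℝ, E) ∞ (chartAt E (1 : G)).symm (chartAt E (1 : G) 1) :=
    (contMDiffOn_chart_symm _ h0).contMDiffAt ((chartAt E (1 : G)).open_target.mem_nhds h0)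
  have m3 : ContMDiffAt 𝓘(ℝ, E × E) 𝓘(ℝ, E) ∞ (fun p : E × E => (chartAt E a).symm p.1)
      (y, chartAt E (1 : G) 1) :=
    ContMDiffAt.comp (g := (chartAt E a).symm) (y, chartAt E (1 : G) 1) m1
      contDiff_fst.contMDiff.contMDiffAt
  have m4 : ContMDiffAt 𝓘(ℝ, E × E) 𝓘(ℝ, E) ∞ (fun p : E × E => (chartAt E (1 : G)).symm p.2)
      (y, chartAt E (1 : G) 1) :=
    ContMDiffAt.comp (g := (chartAt E (1 : G)).symm) (y, chartAt E (1 : G) 1) m2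
      contDiff_snd.contMDiff.contMDiffAt
  have h5 : (chartAt E a).symm y * (chartAt E (1 : G)).symm (chartAt E (1 : G) 1) ∈
      (chartAt E a).source := by
    rw [(chartAt E (1 : G)).left_inv (mem_chart_source E 1), mul_one]
    exact (chartAt E a).map_target hy
  have m5 : ContMDiffAt 𝓘(ℝ, E) 𝓘(ℝ, E) ∞ (chartAt E a)
      ((chartAt E a).symm y * (chartAt E (1 : G)).symm (chartAt E (1 : G) 1)) :=
    (contMDiffOn_chart _ h5).contMDiffAt ((chartAt E a).open_source.mem_nhds h5)
  exact ContMDiffAt.comp (g := chartAt E a) (y, chartAt E (1 : G) 1) m5 (m3.mul m4)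

/-- Exhibits the frame as a partial derivative of the multiplication, a smooth map of two variables
in vector spaces, taken at a fixed value of the second one. Smoothness in `y` is then smooth
dependence of a derivative on parameters. -/
theorem leftFrame_eq_fderiv (a : G) {y : E} (hy : y ∈ (chartAt E a).target) :
    leftFrame E a y = (fderiv ℝ (chartMul a y) (chartAt E (1 : G) 1)).comp
      (chartDerivOne E G) := by
  have e : (fun h : G => chartAt E a ((chartAt E a).symm y * h)) =ᶠ[𝓝 1]
      chartMul a y ∘
        chartAt E (1 : G) := by
    filter_upwards [(chartAt E (1 : G)).open_source.mem_nhds (mem_chart_source E 1)] with h hh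
    simp [chartMul, (chartAt E (1 : G)).left_inv hh]
  have hd : ContDiffAt ℝ ∞ (chartMul a y) (chartAt E (1 : G) 1) :=
    ContDiffAt.comp (g := Function.uncurry (chartMul a)) (chartAt E (1 : G) 1)
      (contDiffAt_chart_mul a hy)
      (contDiffAt_const.prodMk contDiffAt_id)
  have h := e.mfderiv_eq (I := 𝓘(ℝ, E)) (I' := 𝓘(ℝ, E))
  rw [mfderiv_comp (1 : G) (hd.differentiableAt (by simp)).mdifferentiableAt
    ((mdifferentiable_chart (I := 𝓘(ℝ, E)) (1 : G)).mdifferentiableAt (mem_chart_source E 1)),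
    mfderiv_eq_fderiv] at h
  exact h

theorem contDiffOn_leftFrame (a : G) :
    ContDiffOn ℝ ∞ (leftFrame E a) (chartAt E a).target := by
  refine ContDiffOn.congr (fun y hy => ContDiffAt.contDiffWithinAt ?_)
    fun y hy => leftFrame_eq_fderiv a hy
  exact (ContDiffAt.fderiv (f := chartMul a) (g := fun _ => chartAt E (1 : G) 1)
    (contDiffAt_chart_mul a hy) contDiffAt_const (m := ∞) (by simp)).clm_comp contDiffAt_const

theorem hasDerivAt_chart_mul_curveThroughOne (a : G) {y : E} (hy : y ∈ (chartAt E a).target)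
    (v : GroupLieAlgebra 𝓘(ℝ, E) G) :
    HasDerivAt (fun t => chartAt E a ((chartAt E a).symm y * curveThroughOne v t))
      (leftFrame E a y v) 0 := by
  have hd : ContDiffAt ℝ ∞ (chartMul a y) (chartAt E (1 : G) 1) :=
    ContDiffAt.comp (g := Function.uncurry (chartMul a)) (chartAt E (1 : G) 1)
      (contDiffAt_chart_mul a hy)
      (contDiffAt_const.prodMk contDiffAt_id)
  rw [leftFrame_eq_fderiv a hy]
  have h1 : HasDerivAt (fun t : ℝ => chartAt E (1 : G) 1 +
      t • chartDerivOne E G v)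
      (chartDerivOne E G v) 0 := by
    simpa using ((hasDerivAt_id (0 : ℝ)).smul_const
      (chartDerivOne E G v)).const_add
      (chartAt E (1 : G) 1)
  exact HasFDerivAt.comp_hasDerivAt_of_eq (0 : ℝ)
    (hd.differentiableAt (by simp)).hasFDerivAt h1 (by simp)

/-- Left-invariant fields are closed under bracket, and brackets are natural under pullback by the
inverse chart. This is what turns the bracket terms of the formula for `d` into structure constants.
-/
theorem lieBracket_leftFrame [FiniteDimensional ℝ E] (a : G) {y : E}
    (hy : y ∈ (chartAt E a).target) (v w : GroupLieAlgebra 𝓘(ℝ, E) G) :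
    VectorField.lieBracket ℝ (fun z => leftFrame E a z v) (fun z => leftFrame E a z w) y =
      leftFrame E a y (⁅v, w⁆ : GroupLieAlgebra 𝓘(ℝ, E) G) := by
  have : CompleteSpace E := FiniteDimensional.complete ℝ E
  have e : ∀ u : GroupLieAlgebra 𝓘(ℝ, E) G,
      (fun z => leftFrame E a z u) =ᶠ[𝓝 y] fun z =>
        (VectorField.mpullback 𝓘(ℝ, E) 𝓘(ℝ, E) (chartAt E a).symm
          (mulInvariantVectorField u) z : E) := by
    intro u
    filter_upwards [(chartAt E a).open_target.mem_nhds hy] with z hz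
    exact (mpullback_symm_mulInvariantVectorField a hz u).symm
  rw [(e v).lieBracket_vectorField_eq (e w), ← mpullback_symm_mulInvariantVectorField a hy,
    GroupLieAlgebra.bracket_def, mulInvariantVector_mlieBracket,
    VectorField.mpullback_mlieBracket (n := ∞)]
  · rw [← VectorField.mlieBracketWithin_univ, VectorField.mlieBracketWithin_eq_lieBracketWithin]
    exact (congrFun VectorField.lieBracketWithin_univ y).symm
  · exact mdifferentiableAt_mulInvariantVectorField _
  · exact mdifferentiableAt_mulInvariantVectorField _
  · exact (contMDiffOn_chart_symm _ hy).contMDiffAt ((chartAt E a).open_target.mem_nhds hy)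
  · simpa using (ENat.LEInfty.out : (2 : ℕ∞ω) ≤ ∞)

end

/-! ### Coefficients of forms in the left-invariant frame, and invariant forms. -/

namespace LieQuotient

variable {E : Type*} [NormedAddCommGroup E] [NormedSpace ℝ E]
variable {G : Type*} [Group G] [TopologicalSpace G] [ChartedSpace E G] [LieGroup 𝓘(ℝ, E) ∞ G]
variable {Γ : Subgroup G} [DiscreteTopology Γ] {k : ℕ}

/-- The coefficients of a form on `Γ \ G` with respect to the left-invariant vector fields, as a
function on `G`. -/
def coeff (β : FormField E (LieQuotient Γ) k) (g : G) : E [⋀^Fin k]→L[ℝ] ℝ :=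
  FormField.pullback (fun h : G => proj Γ (g * h)) β 1

/-- This invariance is what allows coefficients to be averaged over a fundamental set of `Γ`. -/
theorem coeff_mul_left (β : FormField E (LieQuotient Γ) k) {γ : G} (hγ : γ ∈ Γ) (g : G) :
    coeff β (γ * g) = coeff β g := by
  have h : (fun h : G => proj Γ (γ * g * h)) = fun h => proj Γ (g * h) := by
    funext h
    exact (proj_eq_iff Γ).2 ⟨γ, hγ, by rw [mul_assoc]⟩
  unfold coeff
  rw [h]

theorem coeff_eq_pullback_mul (β : FormField E (LieQuotient Γ) k) (g : G) :
    coeff β g = FormField.pullback (E := E) (fun h : G => g * h)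
      (FormField.pullback (proj Γ) β) 1 :=
  FormField.pullback_comp (proj Γ) (fun h : G => g * h) β 1
    ((contMDiff_proj E Γ).mdifferentiable (by simp) _) (mdifferentiable_mul_left_top E g _)

variable (E Γ) in
theorem contMDiffOn_proj_symm (a : G) : ContMDiffOn 𝓘(ℝ, E) 𝓘(ℝ, E) ∞
    (proj Γ ∘ (chartAt E a).symm) (chartAt E a).target :=
  (contMDiff_proj E Γ).comp_contMDiffOn (contMDiffOn_chart_symm (I := 𝓘(ℝ, E)))

/-- The coefficients of a form in terms of its expression in a chart. -/
theorem coeff_symm (β : FormField E (LieQuotient Γ) k) (a : G) {y : E}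
    (hy : y ∈ (chartAt E a).target) :
    coeff β ((chartAt E a).symm y) =
      (β.onModel (proj Γ ∘ (chartAt E a).symm) y).compContinuousLinearMap (leftFrame E a y) := by
  have e : (fun h : G => proj Γ ((chartAt E a).symm y * h)) =ᶠ[𝓝 1]
      (proj Γ ∘ (chartAt E a).symm) ∘
        fun h : G => chartAt E a ((chartAt E a).symm y * h) := by
    filter_upwards [symm_comp_chart_mul_eventuallyEq a hy] with h hh
    simp only [Function.comp_apply] at hh ⊢
    rw [hh]
  have hyy : chartAt E a ((chartAt E a).symm y * 1) = y := by
    rw [mul_one, (chartAt E a).right_inv hy]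
  have h1 := FormField.pullback_congr β e
  rw [FormField.pullback_comp _ _ _ _ (by
    rw [hyy]
    exact ((contMDiffOn_proj_symm E Γ a).contMDiffAt
      ((chartAt E a).open_target.mem_nhds hy)).mdifferentiableAt (by simp))
    (mdifferentiableAt_chart_mul a hy)] at h1
  have key : ∀ z : E, z = y →
      (β.onModel (proj Γ ∘ (chartAt E a).symm) z).compContinuousLinearMap (leftFrame E a y) =
      (β.onModel (proj Γ ∘ (chartAt E a).symm) y).compContinuousLinearMap (leftFrame E a y) := by
    rintro z rfl; rfl
  exact h1.trans (key _ hyy)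

theorem contDiffOn_coeff_symm {β : FormField E (LieQuotient Γ) k}
    (hβ : β ∈ smoothForms E (LieQuotient Γ) k) (a : G) :
    ContDiffOn ℝ ∞ (fun y => coeff β ((chartAt E a).symm y)) (chartAt E a).target :=
  ((FormField.contDiffOn_onModel hβ (chartAt E a).open_target
    (contMDiffOn_proj_symm E Γ a)).alternatingPullback (contDiffOn_leftFrame a)).congr
    fun _ hy => coeff_symm β a hy

theorem contMDiff_coeff {β : FormField E (LieQuotient Γ) k}
    (hβ : β ∈ smoothForms E (LieQuotient Γ) k) :
    ContMDiff 𝓘(ℝ, E) 𝓘(ℝ, E [⋀^Fin k]→L[ℝ] ℝ) ∞ (coeff β) := by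
  intro a
  have h1 : ContMDiffAt 𝓘(ℝ, E) 𝓘(ℝ, E [⋀^Fin k]→L[ℝ] ℝ) ∞
      (fun y => coeff β ((chartAt E a).symm y)) (chartAt E a a) :=
    ((contDiffOn_coeff_symm hβ a).contDiffAt
      ((chartAt E a).open_target.mem_nhds (mem_chart_target E a))).contMDiffAt
  have h2 : ContMDiffAt 𝓘(ℝ, E) 𝓘(ℝ, E) ∞ (chartAt E a) a :=
    (contMDiffOn_chart _ (mem_chart_source E _)).contMDiffAt
      ((chartAt E a).open_source.mem_nhds (mem_chart_source E a))
  refine (ContMDiffAt.comp (g := fun y => coeff β ((chartAt E a).symm y)) a h1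
    h2).congr_of_eventuallyEq ?_
  filter_upwards [(chartAt E a).open_source.mem_nhds (mem_chart_source E a)] with g hg
  simp [(chartAt E a).left_inv hg]

/-- The exterior derivative of a form in terms of its coefficients with respect to the left-invariant
vector fields. -/
theorem coeff_d [FiniteDimensional ℝ E] {β : FormField E (LieQuotient Γ) (k + 1)}
    (hβ : β ∈ smoothForms E (LieQuotient Γ) (k + 1)) (g : G)
    (X : Fin (k + 2) → GroupLieAlgebra 𝓘(ℝ, E) G) :
    coeff β.d g X =
      (∑ i, (-1) ^ i.val •
        deriv (fun t => coeff β (g * curveThroughOne (X i) t) (i.removeNth X)) 0) -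
      ∑ i : Fin (k + 1), ∑ j ≥ i, (-1) ^ (i + j : ℕ) •
        coeff β g (Matrix.vecCons (⁅X i.castSucc, X j.succ⁆ : GroupLieAlgebra 𝓘(ℝ, E) G)
          (j.removeNth (i.castSucc.removeNth X))) := by
  have : IsTopologicalGroup G := topologicalGroup_of_lieGroup 𝓘(ℝ, E) ∞
  set y := chartAt E g g with hy
  have hyt : y ∈ (chartAt E g).target := mem_chart_target E g
  have hgy : (chartAt E g).symm y = g := (chartAt E g).left_inv (mem_chart_source E g)
  have hnh := (chartAt E g).open_target.mem_nhds hyt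
  set θ := β.onModel (proj Γ ∘ (chartAt E g).symm) with hθ
  have hθd : DifferentiableAt ℝ θ y :=
    ((FormField.contDiffOn_onModel hβ (chartAt E g).open_target
      (contMDiffOn_proj_symm E Γ g)).contDiffAt hnh).differentiableAt (by simp)
  have hPd : DifferentiableAt ℝ (leftFrame E g) y :=
    ((contDiffOn_leftFrame g).contDiffAt hnh).differentiableAt (by simp)
  let V : Fin (k + 2) → E → E := fun i z => leftFrame E g z (X i)
  have hV : ∀ i, DifferentiableAt ℝ (V i) y := fun i => hPd.clm_apply (differentiableAt_const _)
  have h0 : coeff β.d g X = extDeriv θ y (V · y) := by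
    rw [hθ, FormField.extDeriv_onModel hβ (chartAt E g).open_target (contMDiffOn_proj_symm E Γ g)
      hyt]
    have := coeff_symm β.d g hyt
    rw [hgy] at this
    rw [this]
    rfl
  -- The formula for `d` on non-constant vector fields, applied to the frame fields `V i`:
  -- derivatives of the coefficients, and brackets.
  rw [h0, extDeriv_apply_vectorField hθd hV]
  congr 1
  · refine Finset.sum_congr rfl fun i _ => ?_
    congr 1
    have hΘ : ∀ z ∈ (chartAt E g).target, θ z (i.removeNth (V · z)) =
        coeff β ((chartAt E g).symm z) (i.removeNth X) := by
      intro z hz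
      rw [coeff_symm β g hz]
      rfl
    have hΘd : DifferentiableAt ℝ (fun z => θ z (i.removeNth (V · z))) y := by
      have h1 : ContDiffAt ℝ ∞ (fun z => coeff β ((chartAt E g).symm z)) y :=
        (contDiffOn_coeff_symm hβ g).contDiffAt hnh
      have h2 : DifferentiableAt ℝ
          (fun z => coeff β ((chartAt E g).symm z) (i.removeNth X)) y :=
        ((ContinuousAlternatingMap.apply ℝ E ℝ (i.removeNth X)).differentiableAt).comp y
          (h1.differentiableAt (by simp))
      refine h2.congr_of_eventuallyEq ?_
      filter_upwards [hnh] with z hz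
      exact hΘ z hz
    -- A directional derivative depends only on the velocity, so the derivative along `V i` at `y`
    -- can be computed on the translated curve.
    have hc := hasDerivAt_chart_mul_curveThroughOne g hyt (X i)
    have hcurve : ContinuousAt (fun t => (chartAt E g).symm y * curveThroughOne (X i) t) 0 :=
      continuousAt_const.mul (contMDiffAt_curveThroughOne (X i)).continuousAt
    have h3 := HasFDerivAt.comp_hasDerivAt_of_eq (0 : ℝ) hΘd.hasFDerivAt hc
      (by simp [curveThroughOne_zero, (chartAt E g).right_inv hyt])
    rw [show V i y = leftFrame E g y (X i) from rfl, ← h3.deriv]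
    refine Filter.EventuallyEq.deriv_eq ?_
    have h4 : ∀ᶠ t in 𝓝 (0 : ℝ), (chartAt E g).symm y * curveThroughOne (X i) t ∈
        (chartAt E g).source := by
      refine hcurve.eventually ((chartAt E g).open_source.mem_nhds ?_)
      simpa [curveThroughOne_zero] using (chartAt E g).map_target hyt
    filter_upwards [h4] with t ht
    simp only [Function.comp_apply]
    rw [hΘ _ ((chartAt E g).map_source ht), (chartAt E g).left_inv ht, hgy]
  · refine Finset.sum_congr rfl fun i _ => Finset.sum_congr rfl fun j _ => ?_
    congr 1
    have h1 := coeff_symm β g hyt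
    rw [hgy] at h1
    rw [h1, lieBracket_leftFrame g hyt]
    refine congrArg (θ y) (funext fun l => ?_)
    refine Fin.cases ?_ (fun l => ?_) l <;> rfl

/-- A form with vanishing coefficients vanishes. -/
theorem eq_zero_of_coeff_eq_zero [FiniteDimensional ℝ E] {β : FormField E (LieQuotient Γ) k}
    (h : ∀ g, coeff β g = 0) : β = 0 := by
  funext x
  obtain ⟨g, rfl⟩ := proj_surjective Γ x
  have hinv := mfderiv_proj_mul_isInvertible E Γ g
  have h1 : ∀ x : LieQuotient Γ, proj Γ (g * 1) = x → β x = 0 := by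
    rintro x rfl
    refine ContinuousAlternatingMap.ext fun v => ?_
    have h2 := DFunLike.congr_fun (h g) fun i =>
      (mfderiv 𝓘(ℝ, E) 𝓘(ℝ, E) (fun h : G => proj Γ (g * h)) 1 : E →L[ℝ] E).inverse (v i)
    refine Eq.trans ?_ h2
    refine congrArg (β (proj Γ (g * 1))) (funext fun i => ?_)
    exact (hinv.self_apply_inverse (v i)).symm
  exact h1 _ (by rw [mul_one])

/-- Forms with constant coefficients are smooth. -/
theorem mem_smoothForms_of_coeff_eq [FiniteDimensional ℝ E] {β : FormField E (LieQuotient Γ) k}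
    {c : E [⋀^Fin k]→L[ℝ] ℝ} (h : ∀ g, coeff β g = c) :
    β ∈ smoothForms E (LieQuotient Γ) k := by
  have : CompleteSpace E := FiniteDimensional.complete ℝ E
  intro x
  obtain ⟨a, -, hsub, hsymm, -⟩ := exists_chartAt_eq E Γ x
  -- In the chart the form is `c` composed with the inverse frame, and inversion of operators is
  -- smooth.
  have h1 : ContDiffOn ℝ ∞ (fun y => (leftFrame E a y).inverse) (chartAt E a).target := by
    intro y hy
    have h2 := (leftFrame_isInvertible a hy).contDiffAt_map_inverse (n := ∞)
    exact (ContDiffAt.comp y h2 ((contDiffOn_leftFrame a).contDiffAt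
      ((chartAt E a).open_target.mem_nhds hy))).contDiffWithinAt
  have h3 : ContDiffOn ℝ ∞ (fun _ : E => c) (chartAt E a).target := contDiffOn_const
  refine ((h3.alternatingPullback h1).mono hsub).congr fun y hy => ?_
  have h4 : β.inChart x y = β.onModel (proj Γ ∘ (chartAt E a).symm) y := by
    unfold FormField.inChart FormField.onModel
    rw [hsymm]
  rw [h4, ← h ((chartAt E a).symm y), coeff_symm β a (hsub hy)]
  refine ContinuousAlternatingMap.ext fun v => ?_
  refine congrArg (β.onModel (proj Γ ∘ (chartAt E a).symm) y) (funext fun i => ?_)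
  exact ((leftFrame_isInvertible a (hsub hy)).self_apply_inverse (v i)).symm

/-- Forms with constant coefficients are left-invariant. -/
theorem pullback_mul_left_of_coeff_eq {β : FormField E (LieQuotient Γ) k}
    {c : E [⋀^Fin k]→L[ℝ] ℝ} (h : ∀ g, coeff β g = c) (a : G) :
    FormField.pullback (E := E) (fun g : G => a * g) (FormField.pullback (proj Γ) β) =
      FormField.pullback (proj Γ) β := by
  funext g
  -- A form at `g` is recovered from the value at `1` of its pullback under left translation by `g`;
  -- hence the two forms need comparing only there, where the values are coefficients.
  have key : ∀ η : FormField E G k, η g = FormField.pullback (E := E) (fun h : G => g⁻¹ * h)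
      (FormField.pullback (E := E) (fun h : G => g * h) η) g := by
    intro η
    rw [← FormField.pullback_comp _ _ _ _ (mdifferentiable_mul_left_top E _ _)
      (mdifferentiable_mul_left_top E _ _)]
    have : (fun h : G => g * h) ∘ (fun h => g⁻¹ * h) = id := by
      funext h
      simp
    rw [this]
    unfold FormField.pullback
    rw [mfderiv_id]
    rfl
  have h1 : ∀ x : G, x = 1 → FormField.pullback (E := E) (fun h : G => g * h)
      (FormField.pullback (E := E) (fun g : G => a * g) (FormField.pullback (proj Γ) β)) x =
      FormField.pullback (E := E) (fun h : G => g * h) (FormField.pullback (proj Γ) β) x := by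
    rintro x rfl
    rw [← coeff_eq_pullback_mul, h, ← FormField.pullback_comp _ _ _ _
      (mdifferentiable_mul_left_top E _ _) (mdifferentiable_mul_left_top E _ _)]
    have : (fun h : G => a * h) ∘ (fun h => g * h) = fun h => a * g * h := by
      funext h
      simp [mul_assoc]
    rw [this, ← coeff_eq_pullback_mul, h]
  rw [key (FormField.pullback (proj Γ) β),
    key (FormField.pullback (E := E) (fun g : G => a * g) (FormField.pullback (proj Γ) β))]
  unfold FormField.pullback at h1 ⊢
  rw [h1 _ (inv_mul_cancel g)]

variable (Γ) in
/-- The form on `Γ \ G` with given constant coefficients with respect to the left-invariant vector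
fields. -/
def invariantForm (c : E [⋀^Fin k]→L[ℝ] ℝ) : FormField E (LieQuotient Γ) k := fun x =>
  c.compContinuousLinearMap (mfderiv 𝓘(ℝ, E) 𝓘(ℝ, E)
    (fun h : G => proj Γ ((proj_surjective Γ x).choose * h)) 1 : E →L[ℝ] E).inverse

theorem coeff_invariantForm [FiniteDimensional ℝ E] (c : E [⋀^Fin k]→L[ℝ] ℝ) (g : G) :
    coeff (invariantForm Γ c) g = c := by
  have hinv := mfderiv_proj_mul_isInvertible E Γ g
  -- Independence of the chosen preimage: two preimages differ by a left factor in `Γ`, which `proj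
  -- Γ` absorbs. The point is written `g * 1` because that is where `coeff` evaluates the form.
  have h : (fun h : G => proj Γ ((proj_surjective Γ (proj Γ (g * 1))).choose * h)) =
      fun h => proj Γ (g * h) := by
    obtain ⟨γ, hγ, h1⟩ := (proj_eq_iff Γ).1 (proj_surjective Γ (proj Γ (g * 1))).choose_spec
    funext h
    exact (proj_eq_iff Γ).2 ⟨γ, hγ, by rw [← h1]; simp [mul_assoc]⟩
  have h2 : ∀ f : G → LieQuotient Γ, f = (fun h => proj Γ (g * h)) →
      (c.compContinuousLinearMap
        (mfderiv 𝓘(ℝ, E) 𝓘(ℝ, E) f 1 : E →L[ℝ] E).inverse).compContinuousLinearMap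
        (mfderiv 𝓘(ℝ, E) 𝓘(ℝ, E) (fun h : G => proj Γ (g * h)) 1 : E →L[ℝ] E) = c := by
    rintro f rfl
    refine ContinuousAlternatingMap.ext fun v => ?_
    exact congrArg c (funext fun i => hinv.inverse_apply_self (v i))
  exact h2 _ h

end LieQuotient

/-! ### Averaging over `Γ \ G`. -/

section

open MeasureTheory

theorem Continuous.integrable_of_ae_mem_compact {X : Type*} [TopologicalSpace X] [MeasurableSpace X]
    [OpensMeasurableSpace X] {f : X → ℝ} (hf : Continuous f)
    {ν : Measure X} [IsFiniteMeasure ν] {K : Set X} (hK : IsCompact K) (hν : ∀ᵐ g ∂ν, g ∈ K) :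
    Integrable f ν := by
  obtain ⟨C, hC⟩ := hK.exists_bound_of_continuousOn hf.continuousOn
  exact Integrable.of_bound hf.aestronglyMeasurable C (hν.mono fun g hg => hC g hg)

namespace LieQuotient

variable {G : Type*} [Group G] [TopologicalSpace G] [IsTopologicalGroup G]
  [LocallyCompactSpace G] [MeasurableSpace G] [BorelSpace G]

/-- A uniform discrete subgroup has a relatively compact strict fundamental domain. -/
theorem exists_fundamental_set (Γ : Subgroup G) [DiscreteTopology Γ] [CompactSpace (LieQuotient Γ)] :
    ∃ F K : Set G, IsCompact K ∧ F ⊆ K ∧ MeasurableSet F ∧ ∀ g, ∃! γ : Γ, γ • g ∈ F := by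
  have hp := isLocalHomeomorph_proj Γ
  have hU : ∀ g : G, ∃ U K : Set G, IsOpen U ∧ g ∈ U ∧ U ⊆ K ∧ IsCompact K ∧
      Set.InjOn (proj Γ) U := by
    intro g
    obtain ⟨e, hg, he⟩ := hp g
    obtain ⟨K, hK, hgK⟩ := exists_compact_mem_nhds g
    refine ⟨e.source ∩ interior K, K, e.open_source.inter isOpen_interior,
      ⟨hg, mem_interior_iff_mem_nhds.2 hgK⟩, Set.inter_subset_right.trans interior_subset, hK, ?_⟩
    rw [he]
    exact e.injOn.mono Set.inter_subset_left
  choose U K hUo hUg hUK hK hinj using hU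
  obtain ⟨t, ht⟩ := isCompact_univ.elim_finite_subcover (fun g => proj Γ '' U g)
    (fun g => hp.isOpenMap _ (hUo g)) (by
      intro x _
      obtain ⟨g, rfl⟩ := proj_surjective Γ x
      exact Set.mem_iUnion.2 ⟨g, g, hUg g, rfl⟩)
  -- Disjointification by induction: from each new `U a` remove the points whose class is already
  -- represented. The classes represented so far form an open set, which keeps the result
  -- measurable.
  have key : ∀ t : Finset G, ∃ F : Set G, F ⊆ ⋃ g ∈ t, K g ∧ MeasurableSet F ∧
      Set.InjOn (proj Γ) F ∧ proj Γ '' F = ⋃ g ∈ t, proj Γ '' U g := by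
    classical
    intro t
    induction t using Finset.induction_on with
    | empty => exact ⟨∅, by simp⟩
    | insert a t _ ih =>
      obtain ⟨F, hFK, hFm, hFi, hF⟩ := ih
      have hopen : IsOpen (proj Γ '' F) := by
        rw [hF]
        exact isOpen_biUnion fun g _ => hp.isOpenMap _ (hUo g)
      refine ⟨F ∪ (U a \ proj Γ ⁻¹' (proj Γ '' F)), ?_, ?_, ?_, ?_⟩
      · rw [Finset.set_biUnion_insert]
        refine Set.union_subset (hFK.trans Set.subset_union_right) ?_
        exact (Set.sdiff_subset.trans (hUK a)).trans Set.subset_union_left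
      · exact hFm.union ((hUo a).measurableSet.diff (hopen.preimage hp.continuous).measurableSet)
      · rintro x (hx | hx) y (hy | hy) hxy
        · exact hFi hx hy hxy
        · exact absurd ⟨x, hx, hxy⟩ hy.2
        · exact absurd ⟨y, hy, hxy.symm⟩ hx.2
        · exact hinj a hx.1 hy.1 hxy
      · rw [Finset.set_biUnion_insert, Set.image_union, ← hF]
        ext x
        constructor
        · rintro (hx | ⟨y, hy, rfl⟩)
          · exact Or.inr hx
          · exact Or.inl ⟨y, hy.1, rfl⟩
        · rintro (⟨y, hy, rfl⟩ | hx)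
          · by_cases h : proj Γ y ∈ proj Γ '' F
            · exact Or.inl h
            · exact Or.inr ⟨y, ⟨hy, h⟩, rfl⟩
          · exact Or.inl hx
  obtain ⟨F, hFK, hFm, hFi, hF⟩ := key t
  refine ⟨F, ⋃ g ∈ t, K g, t.isCompact_biUnion fun g _ => hK g, hFK, hFm, fun g => ?_⟩
  have hg : proj Γ g ∈ proj Γ '' F := by
    rw [hF]
    exact ht (Set.mem_univ _)
  obtain ⟨f, hf, hfg⟩ := hg
  obtain ⟨γ, hγ, h⟩ := (proj_eq_iff Γ).1 hfg
  refine ⟨⟨γ, hγ⟩, ?_, ?_⟩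
  · change γ * g ∈ F
    rwa [h]
  · rintro ⟨γ', hγ'⟩ h'
    change γ' * g ∈ F at h'
    have h1 : γ' * g = f := hFi h' hf (by
      rw [hfg]
      exact (proj_eq_iff Γ).2 ⟨γ', hγ', rfl⟩)
    exact Subtype.ext (mul_right_cancel (h1.trans h.symm))

variable [SecondCountableTopology G]

/-- For a uniform discrete subgroup `Γ` of `G`, there is a compactly supported finite measure on `G`
such that integration of `Γ`-invariant functions is invariant under right translations. -/
theorem exists_measure_right_invariant (Γ : Subgroup G) [DiscreteTopology Γ]
    [CompactSpace (LieQuotient Γ)] :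
    ∃ (ν : Measure G) (K : Set G), IsCompact K ∧ IsFiniteMeasure ν ∧ (∀ᵐ g ∂ν, g ∈ K) ∧
      ν ≠ 0 ∧ ∀ f : G → ℝ, (∀ γ ∈ Γ, ∀ g, f (γ * g) = f g) →
        ∀ h, ∫ g, f (g * h) ∂ν = ∫ g, f g ∂ν := by
  obtain ⟨F, K, hK, hFK, hF, hΓ⟩ := exists_fundamental_set Γ
  have : Countable Γ := TopologicalSpace.separableSpace_iff_countable.1 inferInstance
  let μ : Measure G := Measure.haar
  have hfin : μ F < ⊤ := (measure_mono hFK).trans_lt hK.measure_lt_top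
  have hD : IsFundamentalDomain Γ F μ := IsFundamentalDomain.mk' hF.nullMeasurableSet hΓ
  have hne : μ F ≠ 0 := hD.measure_ne_zero (NeZero.ne μ)
  refine ⟨μ.restrict F, K, hK, ⟨by simpa using hfin⟩, ?_, by simpa using hne, ?_⟩
  · filter_upwards [ae_restrict_mem hF] with g hg using hFK hg
  -- A right translate of left Haar measure is a multiple of it. The translate `F * h` is again a
  -- fundamental domain, since right translation commutes with the left action of `Γ`, and a
  -- `Γ`-invariant function has the same integral over both.
  have hscale : ∀ h : G, ∃ c : ℝ, ∀ f : G → ℝ, (∀ γ ∈ Γ, ∀ g, f (γ * g) = f g) →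
      ∫ g in F, f (g * h) ∂μ = c * ∫ g in F, f g ∂μ := by
    intro h
    let e : G ≃ₜ G := Homeomorph.mulRight h
    have : (μ.map e).IsHaarMeasure := Measure.isHaarMeasure_map_mul_right μ h
    obtain ⟨c, hc⟩ : ∃ c : NNReal, μ.map e = c • μ :=
      ⟨_, Measure.isMulLeftInvariant_eq_smul (μ.map e) μ⟩
    refine ⟨c, fun f hf => ?_⟩
    have hD' : IsFundamentalDomain Γ (e.symm ⁻¹' F) μ := by
      refine IsFundamentalDomain.mk' (hF.preimage e.symm.measurable).nullMeasurableSet fun g => ?_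
      have h2 : ∀ γ : Γ, γ • g ∈ e.symm ⁻¹' F ↔ γ • e.symm g ∈ F := by
        intro γ
        change (γ : G) * g * h⁻¹ ∈ F ↔ (γ : G) * (g * h⁻¹) ∈ F
        rw [mul_assoc]
      simpa only [h2] using hΓ (e.symm g)
    rw [hD.setIntegral_eq hD' fun γ g => hf γ.1 γ.2 g]
    have h1 : ∫ g in e.symm ⁻¹' F, f g ∂(μ.map e) = ∫ g in F, f (g * h) ∂μ := by
      rw [e.measurableEmbedding.setIntegral_map]
      have : e ⁻¹' (e.symm ⁻¹' F) = F := by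
        ext g; simp
      rw [this]
      rfl
    rw [← h1, hc, Measure.restrict_smul, integral_smul_nnreal_measure]
    rfl
  intro f hf h
  obtain ⟨c, hc⟩ := hscale h
  -- The constant function has a nonzero integral that does not change under translation, which
  -- forces the factor `c` to be `1`.
  have h1 := hc (fun _ => 1) (fun _ _ _ => rfl)
  have h2 : ∫ _ in F, (1 : ℝ) ∂μ ≠ 0 := by
    simp [Measure.real, ENNReal.toReal_eq_zero_iff, hne, hfin.ne]
  have h3 : c = 1 := by
    have : (c - 1) * ∫ _ in F, (1 : ℝ) ∂μ = 0 := by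
      rw [sub_mul, ← h1]
      ring
    rcases mul_eq_zero.1 this with h | h
    · linarith
    · exact absurd h h2
  rw [hc f hf, h3, one_mul]

end LieQuotient

variable {E : Type*} [NormedAddCommGroup E] [NormedSpace ℝ E]
variable {G : Type*} [Group G] [TopologicalSpace G] [ChartedSpace E G] [LieGroup 𝓘(ℝ, E) ∞ G]

/-- The range of `t` depends only on where the curve is differentiable, hence is uniform in `g`, as
differentiation under the integral requires. -/
theorem eventually_differentiableAt_mul_curveThroughOne {b : G → ℝ}
    (hb : ContMDiff 𝓘(ℝ, E) 𝓘(ℝ, ℝ) ∞ b) (v : GroupLieAlgebra 𝓘(ℝ, E) G) :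
    ∀ᶠ t in 𝓝 (0 : ℝ), ∀ g, DifferentiableAt ℝ (fun t => b (g * curveThroughOne v t)) t := by
  have : IsManifold 𝓘(ℝ, E) 1 G := inferInstance
  -- Smoothness of a finite order at a point spreads to a neighbourhood; for order `∞` the
  -- neighbourhood could shrink with the order.
  have h1 : ContMDiffAt 𝓘(ℝ, ℝ) 𝓘(ℝ, E) 1 (curveThroughOne v) 0 :=
    (contMDiffAt_curveThroughOne v).of_le (by simp)
  filter_upwards [(contMDiffAt_iff_contMDiffAt_nhds (by simp)).1 h1] with t ht g
  rw [← mdifferentiableAt_iff_differentiableAt]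
  have h2 : MDifferentiableAt 𝓘(ℝ, ℝ) 𝓘(ℝ, E) (fun t => g * curveThroughOne v t) t :=
    MDifferentiableAt.comp (g := fun x => g * x) t (mdifferentiable_mul_left_top E g _)
      (ht.mdifferentiableAt (by simp))
  exact MDifferentiableAt.comp (g := b) t (hb.mdifferentiable (by simp) _) h2

theorem continuousAt_deriv_mul_curveThroughOne {b : G → ℝ}
    (hb : ContMDiff 𝓘(ℝ, E) 𝓘(ℝ, ℝ) ∞ b) (v : GroupLieAlgebra 𝓘(ℝ, E) G) (g : G) :
    ContinuousAt (fun p : G × ℝ => deriv (fun t => b (p.1 * curveThroughOne v t)) p.2) (g, 0) := by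
  have hf : ContMDiffAt ((𝓘(ℝ, E).prod 𝓘(ℝ, ℝ)).prod 𝓘(ℝ, ℝ)) 𝓘(ℝ, ℝ) ∞
      (Function.uncurry fun (p : G × ℝ) (t : ℝ) => b (p.1 * curveThroughOne v t)) ((g, 0), 0) := by
    have h1 : ContMDiffAt ((𝓘(ℝ, E).prod 𝓘(ℝ, ℝ)).prod 𝓘(ℝ, ℝ)) 𝓘(ℝ, E) ∞
        (fun q : (G × ℝ) × ℝ => curveThroughOne v q.2) ((g, 0), 0) :=
      ContMDiffAt.comp (g := curveThroughOne v) ((g, (0 : ℝ)), (0 : ℝ))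
        (contMDiffAt_curveThroughOne v) contMDiffAt_snd
    have h2 : ContMDiffAt ((𝓘(ℝ, E).prod 𝓘(ℝ, ℝ)).prod 𝓘(ℝ, ℝ)) 𝓘(ℝ, E) ∞
        (fun q : (G × ℝ) × ℝ => q.1.1) ((g, 0), 0) :=
      contMDiffAt_fst.fst
    exact ContMDiffAt.comp (g := b) ((g, (0 : ℝ)), (0 : ℝ)) (hb _) (h2.mul h1)
  -- The parameter is the pair `(g, t)`, whose second entry serves only as the point of
  -- differentiation; this yields continuity jointly in `g` and `t`.
  have h3 := ContMDiffAt.mfderiv (m := 0) (x₀ := (g, (0 : ℝ)))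
    (fun (p : G × ℝ) (t : ℝ) => b (p.1 * curveThroughOne v t)) Prod.snd hf contMDiffAt_snd
    (by simp)
  have h4 := h3.continuousAt
  simp only [inTangentCoordinates_model_space, mfderiv_eq_fderiv] at h4
  exact h4.clm_apply (continuousAt_const (y := (1 : ℝ)))

theorem continuous_deriv_mul_curveThroughOne {b : G → ℝ}
    (hb : ContMDiff 𝓘(ℝ, E) 𝓘(ℝ, ℝ) ∞ b) (v : GroupLieAlgebra 𝓘(ℝ, E) G) :
    Continuous fun g : G => deriv (fun t => b (g * curveThroughOne v t)) 0 :=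
  continuous_iff_continuousAt.2 fun g =>
    ContinuousAt.comp (f := fun g : G => (g, (0 : ℝ)))
      (continuousAt_deriv_mul_curveThroughOne hb v g) (Continuous.prodMk_left 0).continuousAt

variable [MeasurableSpace G] [BorelSpace G]

/-- The integral of the derivative of a function along a left-invariant vector field vanishes if
integration is invariant under right translations. -/
theorem integral_deriv_mul_curveThroughOne_eq_zero {b : G → ℝ}
    (hb : ContMDiff 𝓘(ℝ, E) 𝓘(ℝ, ℝ) ∞ b) (v : GroupLieAlgebra 𝓘(ℝ, E) G) {ν : Measure G}
    [IsFiniteMeasure ν] {K : Set G} (hK : IsCompact K) (hν : ∀ᵐ g ∂ν, g ∈ K)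
    (hinv : ∀ h, ∫ g, b (g * h) ∂ν = ∫ g, b g ∂ν) :
    ∫ g, deriv (fun t => b (g * curveThroughOne v t)) 0 ∂ν = 0 := by
  have : IsTopologicalGroup G := topologicalGroup_of_lieGroup 𝓘(ℝ, E) ∞
  have hcont : ∀ h, Continuous fun g => b (g * h) := fun h =>
    hb.continuous.comp (continuous_mul_const h)
  have hD := continuous_deriv_mul_curveThroughOne hb v
  obtain ⟨C, hC⟩ := hK.exists_bound_of_continuousOn hD.continuousOn
  -- `C` bounds the derivative on `K` at `t = 0`. Joint continuity and compactness of `K` give the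
  -- bound `C + 1` for all small `t` at once.
  have hbd : ∀ᶠ t in 𝓝 (0 : ℝ), ∀ g ∈ K,
      ‖deriv (fun t => b (g * curveThroughOne v t)) t‖ ≤ C + 1 := by
    have := hK.eventually_forall_of_forall_eventually (x₀ := (0 : ℝ))
      (P := fun t g => ‖deriv (fun t => b (g * curveThroughOne v t)) t‖ ≤ C + 1) (by
        intro g hg
        have h1 := ((continuousAt_deriv_mul_curveThroughOne hb v g).norm).comp_of_eq
          (f := Prod.swap) (x := ((0 : ℝ), g)) continuous_swap.continuousAt rfl
        have h2 := h1.eventually_lt (continuousAt_const (y := C + 1)) (by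
          have := hC g hg
          simp only [Function.comp_apply, Prod.swap]
          linarith)
        exact h2.mono fun z hz => hz.le)
    exact this
  have hs := (eventually_differentiableAt_mul_curveThroughOne hb v).and hbd
  have hmain := hasDerivAt_integral_of_dominated_loc_of_deriv_le (μ := ν) (x₀ := (0 : ℝ))
    (F := fun t g => b (g * curveThroughOne v t))
    (F' := fun t g => deriv (fun t => b (g * curveThroughOne v t)) t)
    (bound := fun _ => C + 1) hs
    (Filter.Eventually.of_forall fun t => (hcont _).aestronglyMeasurable)
    ((hcont _).integrable_of_ae_mem_compact hK hν) hD.aestronglyMeasurable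
    (hν.mono fun g hg t ht => ht.2 g hg) (integrable_const _)
    (Filter.Eventually.of_forall fun g t ht => (ht.1 g).hasDerivAt)
  have h1 := hmain.2
  -- By invariance the integral is constant in `t`, so its derivative at `0`, the integral of the
  -- derivatives, is zero.
  simp only [hinv] at h1
  exact h1.unique (hasDerivAt_const _ _)

end

/-! ### The linear algebra behind both isomorphisms. -/

section LinearAlgebra

/-- A linear map whose kernel is contained in `K` and whose target is isomorphic to the quotient of
its source by `K` is surjective, in finite dimension. -/
theorem LinearMap.surjective_of_ker_le_of_equiv_quotient {V W : Type*} [AddCommGroup V] [Module ℝ V]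
    [FiniteDimensional ℝ V] [AddCommGroup W] [Module ℝ W] (f : V →ₗ[ℝ] W) {K : Submodule ℝ V}
    (hK : LinearMap.ker f ≤ K) (e : W ≃ₗ[ℝ] V ⧸ K) : Function.Surjective f := by
  have : FiniteDimensional ℝ W := e.symm.finiteDimensional
  rw [← LinearMap.range_eq_top]
  refine Submodule.eq_top_of_finrank_eq (le_antisymm (Submodule.finrank_le _) ?_)
  -- The rank of `f` is `dim V - dim ker f ≥ dim V - dim K = dim W`.
  have h1 := f.finrank_range_add_finrank_ker
  have h2 := K.finrank_quotient_add_finrank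
  have h3 := Submodule.finrank_mono hK
  have h4 := e.finrank_eq
  omega

/-- Let `Z / B` be the direct sum of the spaces of classes of the elements of `Z` that belong to `F`
and to `F'`, and let `p` be the projection onto `F` along `F'`. If `A ≤ Z` meets all the classes,
then the classes of the elements of `F` correspond to `p A / p B`. -/
theorem exists_equiv_classesModulo {V : Type*} [AddCommGroup V] [Module ℝ V]
    {Z B A F F' : Submodule ℝ V} {p : V →ₗ[ℝ] V} (hB : B ≤ Z) (hAZ : A ≤ Z) (hA : Z ≤ A ⊔ B)
    (hF : ∀ x ∈ F, p x = x) (hF' : ∀ x, x ∈ F' ↔ p x = 0)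
    (hc : IsCompl ((F.submoduleOf Z).map (B.submoduleOf Z).mkQ)
      ((F'.submoduleOf Z).map (B.submoduleOf Z).mkQ)) :
    ∃ e : (F.submoduleOf Z).map (B.submoduleOf Z).mkQ ≃ₗ[ℝ] classesModulo (A.map p) (B.map p),
      ∀ (a : (F.submoduleOf Z).map (B.submoduleOf Z).mkQ) (α : Z), α.1 ∈ F →
        (B.submoduleOf Z).mkQ α = a.1 → (e a).1 = Submodule.Quotient.mk α.1 := by
  -- `s` and `t` map the elements of `F` in `Z` onto the two sides of the isomorphism. Equality of
  -- their kernels gives the equivalence, and its naturality is built in.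
  let s : F.submoduleOf Z →ₗ[ℝ] (F.submoduleOf Z).map (B.submoduleOf Z).mkQ :=
    ((B.submoduleOf Z).mkQ.domRestrict _).codRestrict _ fun x => ⟨x.1, x.2, rfl⟩
  let t : F.submoduleOf Z →ₗ[ℝ] classesModulo (A.map p) (B.map p) :=
    (((B.map p).mkQ.comp Z.subtype).domRestrict _).codRestrict _ fun x => by
      obtain ⟨z, hz, b, hb, hzb⟩ := Submodule.mem_sup.1 (hA x.1.2)
      refine ⟨p z, ⟨z, hz, rfl⟩, ?_⟩
      refine (Submodule.Quotient.eq _).2 ⟨-b, neg_mem hb, ?_⟩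
      have h1 : p x.1.1 = x.1.1 := hF _ x.2
      have h2 : p x.1.1 = p z + p b := by rw [← hzb, map_add]
      change p (-b) = p z - x.1.1
      rw [map_neg, ← h1, h2]
      abel
  have hs : Function.Surjective s := by
    rintro ⟨_, x, hx, rfl⟩
    exact ⟨⟨x, hx⟩, rfl⟩
  have ht : Function.Surjective t := by
    rintro ⟨_, _, ⟨z, hz, rfl⟩, rfl⟩
    -- Surjectivity is fullness: modulo `B`, `z` is `x + y` with `x` in `F` and `y` in `F'`, and `p`
    -- kills `y`.
    have h1 : (B.submoduleOf Z).mkQ ⟨z, hAZ hz⟩ ∈ (F.submoduleOf Z).map (B.submoduleOf Z).mkQ ⊔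
        (F'.submoduleOf Z).map (B.submoduleOf Z).mkQ := by
      rw [hc.sup_eq_top]
      trivial
    obtain ⟨_, ⟨x, hx, rfl⟩, _, ⟨y, hy, rfl⟩, hxy⟩ := Submodule.mem_sup.1 h1
    rw [← map_add] at hxy
    have h2 : x.1 + y.1 - z ∈ B := (Submodule.Quotient.eq (B.submoduleOf Z)).1 hxy
    refine ⟨⟨x, hx⟩, Subtype.ext ((Submodule.Quotient.eq _).2 ⟨_, h2, ?_⟩)⟩
    have h3 : p y.1 = 0 := (hF' _).1 hy
    have h4 : p x.1 = x.1 := hF _ hx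
    rw [map_sub, map_add, h3, h4, add_zero]
    rfl
  have hker : LinearMap.ker s = LinearMap.ker t := by
    ext x
    have hx1 : p x.1.1 = x.1.1 := hF _ x.2
    have e1 : x ∈ LinearMap.ker s ↔ x.1.1 ∈ B := by
      rw [LinearMap.mem_ker, Subtype.ext_iff]
      exact Submodule.Quotient.mk_eq_zero (B.submoduleOf Z)
    have e2 : x ∈ LinearMap.ker t ↔ x.1.1 ∈ B.map p := by
      rw [LinearMap.mem_ker, Subtype.ext_iff]
      exact Submodule.Quotient.mk_eq_zero (B.map p)
    rw [e1, e2]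
    constructor
    · exact fun h => ⟨x.1.1, h, hx1⟩
    · rintro ⟨b, hb, hpb⟩
      -- Equality of kernels is purity: if `x = p b`, then `x` and `x - b` represent the same class,
      -- one in `F` and the other in `F'`, so the class is zero.
      have h1 : x.1.1 - b ∈ F' := by
        rw [hF', map_sub, hx1, hpb, sub_self]
      have h2 : (B.submoduleOf Z).mkQ x.1 = (B.submoduleOf Z).mkQ (x.1 - ⟨b, hB hb⟩) := by
        refine (Submodule.Quotient.eq (B.submoduleOf Z)).2 ?_
        rw [sub_sub_cancel]
        exact hb
      have h3 : (B.submoduleOf Z).mkQ x.1 = 0 :=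
        Submodule.disjoint_def.1 hc.disjoint _ ⟨x.1, x.2, rfl⟩ ⟨_, h1, h2.symm⟩
      exact (Submodule.Quotient.mk_eq_zero (B.submoduleOf Z)).1 h3
  refine ⟨(s.quotKerEquivOfSurjective hs).symm ≪≫ₗ Submodule.quotEquivOfEq _ _ hker ≪≫ₗ
    t.quotKerEquivOfSurjective ht, fun a α hα ha => ?_⟩
  have h1 : a = s ⟨α, hα⟩ := Subtype.ext ha.symm
  have h2 : (s.quotKerEquivOfSurjective hs).symm a = Submodule.Quotient.mk ⟨α, hα⟩ := by
    rw [LinearEquiv.symm_apply_eq, h1]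
    rfl
  rw [LinearEquiv.trans_apply, LinearEquiv.trans_apply, h2]
  rfl

end LinearAlgebra

/-! ### Exact forms are closed; the projections by type. -/

section

variable {E : Type*} [NormedAddCommGroup E] [NormedSpace ℝ E]

/-- The exterior derivative of an exact form vanishes. -/
theorem exactForms2_le_closedForms2 {M : Type*} [TopologicalSpace M] [ChartedSpace E M]
    [IsManifold 𝓘(ℝ, E) ∞ M] : exactForms2 E M ≤ closedForms2 E M := by
  rintro _ ⟨β, rfl⟩
  refine Subtype.ext (funext fun x => ?_)
  have hx := mem_chart_target E x
  have e : FormField.inChart (FormField.d β.1) x =ᶠ[𝓝 (chartAt E x x)]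
      extDeriv (FormField.inChart β.1 x) := by
    filter_upwards [(chartAt E x).open_target.mem_nhds hx] with y hy
    exact FormField.inChart_d β.2 x hy
  have h1 : ContDiffAt ℝ ∞ (FormField.inChart β.1 x) (chartAt E x x) :=
    (β.2 x).contDiffAt ((chartAt E x).open_target.mem_nhds hx)
  have h2 : extDeriv (FormField.inChart (FormField.d β.1) x) (chartAt E x x) = 0 := by
    rw [e.extDeriv_eq]
    exact extDeriv_extDeriv_apply h1 (by simpa using (ENat.LEInfty.out : (2 : ℕ∞ω) ≤ ∞))
  change (extDeriv (FormField.inChart (FormField.d β.1) x) (chartAt E x x)).compContinuousLinearMap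
    (mfderiv 𝓘(ℝ, E) 𝓘(ℝ, E) (chartAt E x) x : E →L[ℝ] E) = 0
  rw [h2]
  rfl

namespace AlmostComplexStructure

variable {M : Type*} [TopologicalSpace M] [ChartedSpace E M] [IsManifold 𝓘(ℝ, E) ∞ M]
variable (J : AlmostComplexStructure E M)

theorem mem_forms11_iff (α : SmoothForm E M 2) : α ∈ J.forms11 ↔ J.act α = α :=
  LinearMap.mem_eqLocus

theorem mem_forms20_iff (α : SmoothForm E M 2) : α ∈ J.forms20 ↔ J.act α = -α :=
  LinearMap.mem_eqLocus

theorem proj11_apply (α : SmoothForm E M 2) : J.proj11 α = (2⁻¹ : ℝ) • (α + J.act α) := rfl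

theorem proj20_apply (α : SmoothForm E M 2) : J.proj20 α = (2⁻¹ : ℝ) • (α - J.act α) := rfl

theorem proj11_eq_self {α : SmoothForm E M 2} (h : α ∈ J.forms11) : J.proj11 α = α := by
  rw [proj11_apply, (J.mem_forms11_iff α).1 h, ← two_smul ℝ, smul_smul]
  simp

theorem proj20_eq_self {α : SmoothForm E M 2} (h : α ∈ J.forms20) : J.proj20 α = α := by
  rw [proj20_apply, (J.mem_forms20_iff α).1 h, sub_neg_eq_add, ← two_smul ℝ, smul_smul]
  simp

theorem mem_forms20_iff_proj11 (α : SmoothForm E M 2) : α ∈ J.forms20 ↔ J.proj11 α = 0 := by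
  rw [mem_forms20_iff, proj11_apply, smul_eq_zero_iff_right (by norm_num), add_comm,
    add_eq_zero_iff_eq_neg]

theorem mem_forms11_iff_proj20 (α : SmoothForm E M 2) : α ∈ J.forms11 ↔ J.proj20 α = 0 := by
  rw [mem_forms11_iff, proj20_apply, smul_eq_zero_iff_right (by norm_num), sub_eq_zero, eq_comm]

end AlmostComplexStructure

end

/-! ### The comparison of `H²(𝔤)` with `H²(M)`. -/

section

instance : FiniteDimensional ℝ TrivialReal := inferInstanceAs (FiniteDimensional ℝ ℝ)

instance (L : Type*) [LieRing L] [LieAlgebra ℝ L] [FiniteDimensional ℝ L] :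
    FiniteDimensional ℝ (CECochain2 L) :=
  inferInstanceAs (FiniteDimensional ℝ (LieModule.Cohomology.twoCochain ℝ L TrivialReal))

variable {E : Type*} [NormedAddCommGroup E] [NormedSpace ℝ E] [FiniteDimensional ℝ E]
variable {G : Type*} [Group G] [TopologicalSpace G] [ChartedSpace E G] [LieGroup 𝓘(ℝ, E) ∞ G]

instance : FiniteDimensional ℝ (GroupLieAlgebra 𝓘(ℝ, E) G) :=
  inferInstanceAs (FiniteDimensional ℝ E)

/-- An alternating bilinear form on a finite-dimensional space as a continuous alternating map. -/
def alternatingOfBilin (B : E →ₗ[ℝ] E →ₗ[ℝ] ℝ) (hB : ∀ x, B x x = 0) : E [⋀^Fin 2]→L[ℝ] ℝ where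
  toFun v := B (v 0) (v 1)
  map_update_add' := by
    intro inst v i x y
    rw [Subsingleton.elim inst (instDecidableEqFin 2)]
    fin_cases i <;> simp
  map_update_smul' := by
    intro inst v i r x
    rw [Subsingleton.elim inst (instDecidableEqFin 2)]
    fin_cases i <;> simp
  cont := by
    let B' : E →L[ℝ] E →L[ℝ] ℝ :=
      LinearMap.toContinuousLinearMap (LinearMap.toContinuousLinearMap.toLinearMap ∘ₗ B)
    change Continuous fun v : Fin 2 → E => B' (v 0) (v 1)
    fun_prop
  map_eq_zero_of_eq' := by
    intro v i j hv hij
    change B (v 0) (v 1) = 0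
    fin_cases i <;> fin_cases j
    · exact absurd rfl hij
    · rw [show v 0 = v 1 from hv, hB]
    · rw [show v 0 = v 1 from hv.symm, hB]
    · exact absurd rfl hij

variable (E G) in
/-- A Chevalley-Eilenberg 2-cochain of the Lie algebra, regarded as an alternating form on the model
space. -/
def cochainForm : CECochain2 (GroupLieAlgebra 𝓘(ℝ, E) G) →ₗ[ℝ] E [⋀^Fin 2]→L[ℝ] ℝ where
  toFun c := alternatingOfBilin c.1 c.2
  map_add' _ _ := rfl
  map_smul' _ _ := rfl

theorem ContinuousAlternatingMap.map_vec_one_add {V : Type*} [NormedAddCommGroup V]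
    [NormedSpace ℝ V] (a : V [⋀^Fin 1]→L[ℝ] ℝ) (x y : V) : a ![x + y] = a ![x] + a ![y] := by
  have h : ∀ z : V, Function.update ![(0 : V)] 0 z = ![z] := fun z => by
    funext i
    fin_cases i
    rfl
  simpa only [h] using a.map_update_add ![(0 : V)] 0 x y

theorem ContinuousAlternatingMap.map_vec_one_smul {V : Type*} [NormedAddCommGroup V]
    [NormedSpace ℝ V] (a : V [⋀^Fin 1]→L[ℝ] ℝ) (r : ℝ) (x : V) : a ![r • x] = r * a ![x] := by
  have h : ∀ z : V, Function.update ![(0 : V)] 0 z = ![z] := fun z => by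
    funext i
    fin_cases i
    rfl
  simpa only [h, smul_eq_mul] using a.map_update_smul ![(0 : V)] 0 r x

theorem sum_Ici_zero_fin_two (f : Fin 2 → ℝ) : ∑ j ∈ Finset.Ici (0 : Fin 2), f j = f 0 + f 1 := by
  rw [show Finset.Ici (0 : Fin 2) = {0, 1} by decide, Finset.sum_pair (by decide)]

theorem sum_Ici_one_fin_two (f : Fin 2 → ℝ) : ∑ j ∈ Finset.Ici (1 : Fin 2), f j = f 1 := by
  rw [show Finset.Ici (1 : Fin 2) = {1} by decide, Finset.sum_singleton]

theorem sum_Ici_zero_fin_one (f : Fin 1 → ℝ) : ∑ j ∈ Finset.Ici (0 : Fin 1), f j = f 0 := by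
  rw [show Finset.Ici (0 : Fin 1) = {0} by decide, Finset.sum_singleton]

namespace LieQuotient

variable {Γ : Subgroup G} [DiscreteTopology Γ]

/-- The coefficients are constant, so only the bracket terms of `coeff_d` survive; their sum
vanishes by the cocycle identity and skew-symmetry. -/
theorem d_invariantForm {c : CECochain2 (GroupLieAlgebra 𝓘(ℝ, E) G)}
    (hc : c ∈ ceCocycles2 (GroupLieAlgebra 𝓘(ℝ, E) G)) :
    (invariantForm Γ (cochainForm E G c)).d = 0 := by
  refine eq_zero_of_coeff_eq_zero fun g => ContinuousAlternatingMap.ext fun X => ?_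
  have hco := coeff_invariantForm (Γ := Γ) (cochainForm E G c)
  have h := coeff_d (mem_smoothForms_of_coeff_eq hco) g X
  simp only [hco, deriv_const, smul_zero, Finset.sum_const_zero, zero_sub] at h
  refine h.trans (neg_eq_zero.2 ((Fin.sum_univ_two _).trans ?_))
  refine (congrArg₂ (· + ·) (sum_Ici_zero_fin_two _) (sum_Ici_one_fin_two _)).trans ?_
  let Y : Fin 3 → GroupLieAlgebra 𝓘(ℝ, E) G := X
  let C : GroupLieAlgebra 𝓘(ℝ, E) G → GroupLieAlgebra 𝓘(ℝ, E) G → ℝ := fun x y => c.1 x y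
  have hcoc := (LieModule.Cohomology.mem_twoCocycle_iff_of_trivial ℝ
    (GroupLieAlgebra 𝓘(ℝ, E) G) TrivialReal c).1 hc (Y 0) (Y 1) (Y 2)
  have hcoc' : C (Y 0) ⁅Y 1, Y 2⁆ = C ⁅Y 0, Y 1⁆ (Y 2) + C (Y 1) ⁅Y 0, Y 2⁆ := hcoc
  have hskew : ∀ x y, - C x y = C y x := LieModule.Cohomology.twoCochain_skew c
  -- The bracket of the pair `(i, j)` is that of `X i` and `X (j + 1)`, so `(0, 0)`, `(0, 1)`, `(1,
  -- 1)` stand for the pairs `01`, `02`, `12` of arguments.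
  change ((-1 : ℤ) ^ 0 • C ⁅Y 0, Y 1⁆ (Y 2) + (-1 : ℤ) ^ 1 • C ⁅Y 0, Y 2⁆ (Y 1)) +
    (-1 : ℤ) ^ 2 • C ⁅Y 1, Y 2⁆ (Y 0) = 0
  have h1 := hskew (Y 0) ⁅Y 1, Y 2⁆
  have h2 := hskew (Y 1) ⁅Y 0, Y 2⁆
  simp
  linarith

/-- The exterior derivative of a 1-form in terms of its coefficients. -/
theorem coeff_d_one {β : FormField E (LieQuotient Γ) 1}
    (hβ : β ∈ smoothForms E (LieQuotient Γ) 1) (g : G) (v w : GroupLieAlgebra 𝓘(ℝ, E) G) :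
    coeff β.d g ![(v : E), w] =
      deriv (fun t => coeff β (g * curveThroughOne v t) ![w]) 0 -
      deriv (fun t => coeff β (g * curveThroughOne w t) ![v]) 0 -
      coeff β g ![(⁅v, w⁆ : GroupLieAlgebra 𝓘(ℝ, E) G)] := by
  refine (coeff_d hβ g ![v, w]).trans ?_
  have h0 : (0 : Fin 2).removeNth ![v, w] = ![w] := by
    funext i
    fin_cases i
    rfl
  have h1 : (1 : Fin 2).removeNth ![v, w] = ![v] := by
    funext i
    fin_cases i
    rfl
  refine congrArg₂ (· - ·) ((Fin.sum_univ_two _).trans ?_) ((Fin.sum_univ_one _).trans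
    ((sum_Ici_zero_fin_one _).trans ?_))
  · rw [h0, h1]
    simp [sub_eq_add_neg]
    rfl
  · refine Eq.trans (b := (-1 : ℤ) ^ 0 • coeff β g ![(⁅v, w⁆ : GroupLieAlgebra 𝓘(ℝ, E) G)]) ?_ (by simp)
    refine congrArg (fun a => (-1 : ℤ) ^ 0 • coeff β g a) ?_
    funext i
    fin_cases i
    rfl

/-- If the invariant form of a Chevalley-Eilenberg cochain on a compact quotient is exact, then the
cochain is a coboundary. -/
theorem mem_ceCoboundaries2_of_d_eq [SecondCountableTopology G] [CompactSpace (LieQuotient Γ)]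
    {c : CECochain2 (GroupLieAlgebra 𝓘(ℝ, E) G)} {β : FormField E (LieQuotient Γ) 1}
    (hβ : β ∈ smoothForms E (LieQuotient Γ) 1) (h : β.d = invariantForm Γ (cochainForm E G c)) :
    c ∈ ceCoboundaries2 (GroupLieAlgebra 𝓘(ℝ, E) G) := by
  have : IsTopologicalGroup G := topologicalGroup_of_lieGroup 𝓘(ℝ, E) ∞
  have : LocallyCompactSpace G := Manifold.locallyCompact_of_finiteDimensional 𝓘(ℝ, E)
  let _ : MeasurableSpace G := borel G
  have : BorelSpace G := ⟨rfl⟩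
  obtain ⟨ν, K, hK, _, hνK, hν0, hinv⟩ := exists_measure_right_invariant Γ
  let b : GroupLieAlgebra 𝓘(ℝ, E) G → G → ℝ := fun v g => coeff β g ![(v : E)]
  have hb : ∀ v, ContMDiff 𝓘(ℝ, E) 𝓘(ℝ, ℝ) ∞ (b v) := fun v =>
    (ContinuousAlternatingMap.apply ℝ E ℝ ![(v : E)]).contMDiff.comp (contMDiff_coeff hβ)
  have hbint : ∀ v, MeasureTheory.Integrable (b v) ν := fun v =>
    (hb v).continuous.integrable_of_ae_mem_compact hK hνK
  have hbΓ : ∀ v, ∀ γ ∈ Γ, ∀ g, b v (γ * g) = b v g := fun v γ hγ g => by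
    simp only [b, coeff_mul_left β hγ g]
  have hzero : ∀ v w, ∫ g, deriv (fun t => b w (g * curveThroughOne v t)) 0 ∂ν = 0 := fun v w =>
    integral_deriv_mul_curveThroughOne_eq_zero (hb w) v hK hνK (hinv _ (hbΓ w))
  have hdint : ∀ v w, MeasureTheory.Integrable
      (fun g => deriv (fun t => b w (g * curveThroughOne v t)) 0) ν := fun v w =>
    (continuous_deriv_mul_curveThroughOne (hb w) v).integrable_of_ae_mem_compact hK hνK
  let C : GroupLieAlgebra 𝓘(ℝ, E) G → GroupLieAlgebra 𝓘(ℝ, E) G → ℝ := fun x y => c.1 x y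
  have hC : ∀ v w, ∀ g, C v w = deriv (fun t => b w (g * curveThroughOne v t)) 0 -
      deriv (fun t => b v (g * curveThroughOne w t)) 0 - b ⁅v, w⁆ g := by
    intro v w g
    refine Eq.trans ?_ (coeff_d_one hβ g v w)
    rw [h, coeff_invariantForm]
    rfl
  have hm : ν.real Set.univ ≠ 0 := by
    simp [MeasureTheory.measureReal_def, ENNReal.toReal_eq_zero_iff, hν0]
  -- The identity `hC` holds at every `g` with a constant left side; integrating it removes both
  -- derivative terms.
  have hCint : ∀ v w, ν.real Set.univ * C v w = -∫ g, b ⁅v, w⁆ g ∂ν := by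
    intro v w
    have h1 : ∫ _, C v w ∂ν = ν.real Set.univ * C v w := by simp
    have h2 := MeasureTheory.integral_sub ((hdint v w).sub (hdint w v)) (hbint ⁅v, w⁆)
    have h3 := MeasureTheory.integral_sub (hdint v w) (hdint w v)
    simp only [Pi.sub_apply] at h2
    rw [← h1, MeasureTheory.integral_congr_ae (Filter.Eventually.of_forall (hC v w)), h2, h3,
      hzero, hzero]
    simp
  have hadd : ∀ v w g, b (v + w) g = b v g + b w g := fun v w g =>
    (coeff β g).map_vec_one_add v w
  have hsmul : ∀ (r : ℝ) v g, b (r • v) g = r * b v g := fun r v g =>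
    (coeff β g).map_vec_one_smul r v
  -- The average of `β`: on `v`, the mean of its coefficient. The minus sign in `hCint` matches the
  -- convention by which `d₁₂` sends `η` to `-η ⁅v, w⁆`.
  let η : GroupLieAlgebra 𝓘(ℝ, E) G →ₗ[ℝ] ℝ :=
    { toFun := fun v => (ν.real Set.univ)⁻¹ * ∫ g, b v g ∂ν
      map_add' := fun v w => by
        simp only [hadd]
        rw [MeasureTheory.integral_add (hbint v) (hbint w), mul_add]
      map_smul' := fun r v => by
        simp only [hsmul]
        rw [MeasureTheory.integral_const_mul]
        simp only [RingHom.id_apply, smul_eq_mul]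
        ring }
  let η' : GroupLieAlgebra 𝓘(ℝ, E) G →ₗ[ℝ] TrivialReal := η
  refine ⟨η', Subtype.ext (LinearMap.ext fun v => LinearMap.ext fun w => ?_)⟩
  refine (LieModule.Cohomology.d₁₂_apply_apply_ofTrivial ℝ _ TrivialReal η' v w).trans ?_
  change -((ν.real Set.univ)⁻¹ * ∫ g, b ⁅v, w⁆ g ∂ν) = C v w
  have := hCint v w
  field_simp
  linarith

variable (Γ) in
/-- The closed form on `Γ \ G` defined by a Chevalley-Eilenberg 2-cocycle. -/
def cocycleForm : ceCocycles2 (GroupLieAlgebra 𝓘(ℝ, E) G) →ₗ[ℝ]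
    closedForms2 E (LieQuotient Γ) where
  toFun c := ⟨⟨invariantForm Γ (cochainForm E G c.1),
    mem_smoothForms_of_coeff_eq (coeff_invariantForm _)⟩, Subtype.ext (d_invariantForm c.2)⟩
  map_add' _ _ := rfl
  map_smul' _ _ := rfl

/-- Every closed 2-form on a compact quotient whose second cohomology is that of the Lie algebra is
cohomologous to an invariant form. -/
theorem closedForms2_le_sup [SecondCountableTopology G] [CompactSpace (LieQuotient Γ)]
    (hH : Nonempty (DeRhamH2 E (LieQuotient Γ) ≃ₗ[ℝ]
      ChevalleyEilenbergH2 (GroupLieAlgebra 𝓘(ℝ, E) G))) :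
    closedForms2 E (LieQuotient Γ) ≤
      closedInvariantForms2 E Γ ⊔ exactForms2 E (LieQuotient Γ) := by
  obtain ⟨e⟩ := hH
  -- Injectivity of the natural map on cohomology: an exact invariant form comes from a coboundary.
  have hker : LinearMap.ker ((deRhamClass E (LieQuotient Γ)).comp (cocycleForm Γ)) ≤
      (ceCoboundaries2 (GroupLieAlgebra 𝓘(ℝ, E) G)).submoduleOf
        (ceCocycles2 (GroupLieAlgebra 𝓘(ℝ, E) G)) := by
    intro c hc
    obtain ⟨β, hβ⟩ := (Submodule.Quotient.mk_eq_zero _).1 (LinearMap.mem_ker.1 hc)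
    exact mem_ceCoboundaries2_of_d_eq β.2 (congrArg Subtype.val hβ)
  intro α hα
  -- The isomorphism `e` need not be the natural one: it enters only through the dimensions.
  obtain ⟨c, hc⟩ := LinearMap.surjective_of_ker_le_of_equiv_quotient _ hker e
    (deRhamClass E (LieQuotient Γ) ⟨α, hα⟩)
  have h1 : α - (cocycleForm Γ c).1 ∈ exactForms2 E (LieQuotient Γ) :=
    (Submodule.Quotient.eq ((exactForms2 E (LieQuotient Γ)).submoduleOf _)).1 hc.symm
  refine Submodule.mem_sup.2 ⟨(cocycleForm Γ c).1, ⟨(cocycleForm Γ c).2, fun a => ?_⟩, _, h1,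
    by abel⟩
  exact pullback_mul_left_of_coeff_eq (coeff_invariantForm (cochainForm E G c.1)) a

end LieQuotient

end

end

theorem theorem3
    {E : Type*} [NormedAddCommGroup E] [NormedSpace ℝ E] [FiniteDimensional ℝ E]
    {G : Type*} [Group G] [TopologicalSpace G] [T2Space G] [SecondCountableTopology G]
    [ChartedSpace E G] [LieGroup 𝓘(ℝ, E) ∞ G]
    (Γ : Subgroup G) [DiscreteTopology Γ] [CompactSpace (LieQuotient Γ)]
    (hH : Nonempty (DeRhamH2 E (LieQuotient Γ) ≃ₗ[ℝ]
      ChevalleyEilenbergH2 (GroupLieAlgebra 𝓘(ℝ, E) G)))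
    (J : AlmostComplexStructure E (LieQuotient Γ)) (hJ : J.IsPureAndFull) :
    (∃ e : J.H11 ≃ₗ[ℝ] classesModulo
        ((LieQuotient.closedInvariantForms2 E Γ).map J.proj11)
        ((exactForms2 E (LieQuotient Γ)).map J.proj11),
      ∀ (a : J.H11) (α : closedForms2 E (LieQuotient Γ)),
        α.1 ∈ J.forms11 → deRhamClass E (LieQuotient Γ) α = a.1 →
          (e a).1 = Submodule.Quotient.mk α.1) ∧
    (∃ e : J.H20 ≃ₗ[ℝ] classesModulo
        ((LieQuotient.closedInvariantForms2 E Γ).map J.proj20)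
        ((exactForms2 E (LieQuotient Γ)).map J.proj20),
      ∀ (a : J.H20) (α : closedForms2 E (LieQuotient Γ)),
        α.1 ∈ J.forms20 → deRhamClass E (LieQuotient Γ) α = a.1 →
          (e a).1 = Submodule.Quotient.mk α.1) := by
  have hA := LieQuotient.closedForms2_le_sup hH
  have hAZ : LieQuotient.closedInvariantForms2 E Γ ≤ closedForms2 E (LieQuotient Γ) :=
    fun _ h => h.1
  -- The two halves are one statement with the types exchanged: each projection fixes the forms of
  -- its own type, and its kernel is the other type.
  exact ⟨exists_equiv_classesModulo exactForms2_le_closedForms2 hAZ hA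
      (fun _ => J.proj11_eq_self) J.mem_forms20_iff_proj11 hJ,
    exists_equiv_classesModulo exactForms2_le_closedForms2 hAZ hA
      (fun _ => J.proj20_eq_self) J.mem_forms11_iff_proj20 hJ.symm⟩
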